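/- **Conventions.** Let $M$ be a transitive set. A *class over $M$* is a subset of $M$, and for a family $\mathcal X\subseteq\mathcal P(M)$ the pair $(M,\mathcal X)$ is the two-sorted structure with sets $M$, classes $\mathcal X$ and the true membership relation. $(M,\mathcal X)\models\mathsf{GB}$ (Gödel–Bernays class theory, without global choice) means: $(M,\in)\models\mathsf{ZFC}$; $\mathcal X$ satisfies predicative comprehension, i.e. whenever $P_1,\dots,P_k\in\mathcal X$, every subset of $M$ that is first-order definable with parameters from $M$ over $(M,\in,P_1,\dots,P_k)$ belongs to $\mathcal X$; and class replacement holds, i.e. for every class function $F\in\mathcal X$ and $a\in M$ the image $F''a$ is an element of $M$. In that case $\mathcal X$ is called a *$\mathsf{GB}$-expansion for $M$*. For $A\subseteq M$, $\mathrm{Def}(M,A)$ is the family of all subsets of $M$ that are first-order definable with parameters from $M$ over $(M,\in,A)$. The *truth predicate relative to $A$*, $\mathrm{Tr}(A)^M\subseteq M$, is the class of all pairs $(\ulcorner\varphi\urcorner,\vec a)$ where $\varphi$ is a first-order formula in the language of $(M,\in,A)$, coded as a hereditarily finite set, $\vec a$ is a finite tuple from $M$, and $(M,\in,A)\models\varphi(\vec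 a)$. Let $\mathrm{Add}(\mathrm{Ord},1)^M$ be the class of all functions $p\in M$ from an ordinal of $M$ to $\{0,1\}$, ordered by end-extension. A class $C\subseteq\mathrm{Ord}^M$ is *Cohen-generic over $(M,\mathcal X)$* if for every dense $D\subseteq\mathrm{Add}(\mathrm{Ord},1)^M$ with $D\in\mathcal X$ some initial segment of the characteristic function of $C$ belongs to $D$. **Theorem.** Let $M$ be a countable transitive model of $\mathsf{ZFC}$ and let $A\subseteq M$ be a class over $M$ such that $(M,\mathrm{Def}(M,A))\models\mathsf{GB}$. Then there is a class $C$ that is Cohen-generic over $(M,\mathrm{Def}(M,A))$ such that no $\mathsf{GB}$-expansion for $M$ contains both $C$ and $\mathrm{Tr}(A)^M$. -/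

import Mathlib

universe u

namespace ClassTheory

/-! ### First-order formulas over `(M, ∈, P₀, …, P_{k-1})` -/

/-- Relation symbols: a binary symbol for membership and `k` unary symbols for classes. -/
inductive SetRel (k : ℕ) : ℕ → Type
  | mem : SetRel k 2
  | cls (i : Fin k) : SetRel k 1

/-- The language `{∈, P₀, …, P_{k-1}}` with a binary membership symbol and `k` unary predicates. -/
def setLang (k : ℕ) : FirstOrder.Language.{0, 0} where
  Functions := fun _ => Empty
  Relations := SetRel k

/-- The structure `(M, ∈, P₀, …, P_{k-1})`, where `∈` is the true membership relation
and a class over `M` is a subset of `M`. -/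
@[reducible] def classStructure (M : ZFSet.{u}) {k : ℕ} (P : Fin k → Set M) : (setLang k).Structure M where
  funMap := fun {_} f _ => Empty.elim f
  RelMap := fun {_} R =>
    match R with
    | SetRel.mem => fun v => (v 0 : ZFSet.{u}) ∈ (v 1 : ZFSet.{u})
    | SetRel.cls i => fun v => v 0 ∈ P i

/-- `Y ⊆ M` is first-order definable, with parameters from `M`, over `(M, ∈, P₀, …, P_{k-1})`. -/
def DefinableFrom (M : ZFSet.{u}) {k : ℕ} (P : Fin k → Set M) (Y : Set M) : Prop :=
  letI := classStructure M P
  (Set.univ : Set M).Definable₁ (setLang k) Y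

/-- `F ⊆ M × M` is first-order definable, with parameters from `M`, over
`(M, ∈, P₀, …, P_{k-1})`. -/
def DefinableRelFrom (M : ZFSet.{u}) {k : ℕ} (P : Fin k → Set M) (F : Set (M × M)) : Prop :=
  letI := classStructure M P
  (Set.univ : Set M).Definable₂ (setLang k) F

/-- `Def(M, A)`: the classes over `M` definable with parameters over `(M, ∈, A)`. -/
def Def (M : ZFSet.{u}) (A : Set M) : Set (Set M) :=
  {Y | DefinableFrom M ![A] Y}

/-! ### The theories ZFC and GB -/

/-- `(M, ∈) ⊨ ZFC`: all quantifiers are relativised to `M`, and the two schemes are stated for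
everything first-order definable over `(M, ∈)` with parameters. -/
structure ModelsZFC (M : ZFSet.{u}) : Prop where
  extensionality : ∀ x y : M, (∀ z : M, z.1 ∈ x.1 ↔ z.1 ∈ y.1) → x = y
  foundation : ∀ x : M, (∃ y : M, y.1 ∈ x.1) →
    ∃ y : M, y.1 ∈ x.1 ∧ ∀ z : M, z.1 ∈ x.1 → z.1 ∉ y.1
  pairing : ∀ x y : M, ∃ z : M, ∀ w : M, w.1 ∈ z.1 ↔ w = x ∨ w = y
  union : ∀ x : M, ∃ u : M, ∀ z : M, z.1 ∈ u.1 ↔ ∃ y : M, y.1 ∈ x.1 ∧ z.1 ∈ y.1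
  powerset : ∀ x : M, ∃ p : M, ∀ z : M, z.1 ∈ p.1 ↔ ∀ w : M, w.1 ∈ z.1 → w.1 ∈ x.1
  infinity : ∃ w : M, (∃ e : M, e.1 ∈ w.1 ∧ ∀ z : M, z.1 ∉ e.1) ∧
    ∀ x : M, x.1 ∈ w.1 → ∃ y : M, y.1 ∈ w.1 ∧ ∀ z : M, z.1 ∈ y.1 ↔ z.1 ∈ x.1 ∨ z = x
  separation : ∀ Y : Set M, DefinableFrom M ![] Y →
    ∀ a : M, ∃ b : M, ∀ z : M, z.1 ∈ b.1 ↔ z.1 ∈ a.1 ∧ z ∈ Y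
  replacement : ∀ F : Set (M × M), DefinableRelFrom M ![] F →
    (∀ x y y' : M, (x, y) ∈ F → (x, y') ∈ F → y = y') →
    ∀ a : M, ∃ b : M, ∀ y : M, y.1 ∈ b.1 ↔ ∃ x : M, x.1 ∈ a.1 ∧ (x, y) ∈ F
  choice : ∀ a : M, (∀ x : M, x.1 ∈ a.1 → ∃ y : M, y.1 ∈ x.1) →
    (∀ x x' : M, x.1 ∈ a.1 → x'.1 ∈ a.1 → (∃ y : M, y.1 ∈ x.1 ∧ y.1 ∈ x'.1) → x = x') →
    ∃ c : M, ∀ x : M, x.1 ∈ a.1 → ∃! y : M, y.1 ∈ x.1 ∧ y.1 ∈ c.1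

/-- The Kuratowski pair `(x, y)` belongs to the class `F`. -/
def PairMem {M : ZFSet.{u}} (F : Set M) (x y : M) : Prop :=
  ∃ p ∈ F, p.1 = ZFSet.pair x.1 y.1

/-- `F` is a class function: a class of ordered pairs that is single-valued. -/
def IsClassFunction {M : ZFSet.{u}} (F : Set M) : Prop :=
  (∀ p ∈ F, ∃ x y : M, p.1 = ZFSet.pair x.1 y.1) ∧
    ∀ x y y' : M, PairMem F x y → PairMem F x y' → y = y'

/-- `(M, X) ⊨ GB`, where the classes are the members of the family `X` of subsets of `M`.
Extensionality for classes holds because classes are subsets of `M`. -/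
structure ModelsGB (M : ZFSet.{u}) (X : Set (Set M)) : Prop where
  zfc : ModelsZFC M
  comprehension : ∀ (k : ℕ) (P : Fin k → Set M), (∀ i, P i ∈ X) →
    ∀ Y : Set M, DefinableFrom M P Y → Y ∈ X
  class_replacement : ∀ F ∈ X, IsClassFunction F →
    ∀ a : M, ∃ b : M, ∀ y : M, y.1 ∈ b.1 ↔ ∃ x : M, x.1 ∈ a.1 ∧ PairMem F x y

/-! ### The truth predicate -/

/-- The natural number `n` as a von Neumann ordinal. -/
noncomputable def natCode (n : ℕ) : ZFSet.{u} := Ordinal.toZFSet (n : Ordinal.{u})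

/-- Terms of the language are variables; this is the index of the variable. -/
def varIndex {k n : ℕ} : (setLang k).Term (Empty ⊕ Fin n) → ℕ
  | .var (.inl e) => Empty.elim e
  | .var (.inr i) => i
  | .func f _ => Empty.elim f

/-- The code of an atomic formula `x ∈ y` or `Pᵢ(x)`. -/
noncomputable def relCode {k : ℕ} : {l : ℕ} → SetRel k l → (Fin l → ℕ) → ZFSet.{u}
  | _, .mem, v => ZFSet.pair (natCode 2) (ZFSet.pair (natCode (v 0)) (natCode (v 1)))
  | _, .cls i, v => ZFSet.pair (natCode 3) (ZFSet.pair (natCode i) (natCode (v 0)))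

/-- The hereditarily finite set `⌜φ⌝` coding a formula `φ` whose free variables are among
`x₀, …, x_{n-1}` (a quantifier in `φ` binds the next variable `x_n`). -/
noncomputable def formulaCode {k : ℕ} :
    {n : ℕ} → (setLang k).BoundedFormula Empty n → ZFSet.{u}
  | _, .falsum => ZFSet.pair (natCode 0) ∅
  | _, .equal s t => ZFSet.pair (natCode 1)
      (ZFSet.pair (natCode (varIndex s)) (natCode (varIndex t)))
  | _, .rel R ts => relCode R (fun i => varIndex (ts i))
  | _, .imp φ ψ => ZFSet.pair (natCode 4) (ZFSet.pair (formulaCode φ) (formulaCode ψ))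
  | _, .all φ => ZFSet.pair (natCode 5) (formulaCode φ)

/-- The finite sequence `⟨v₀, …, v_{n-1}⟩` as a set-theoretic function with domain `n`. -/
noncomputable def tupleCode {M : ZFSet.{u}} {n : ℕ} (v : Fin n → M) : ZFSet.{u} :=
  ZFSet.range (fun i : Fin n => ZFSet.pair (natCode i) (v i).1)

/-- Tarskian satisfaction `(M, ∈, A) ⊨ φ[v]`. -/
def Satisfies (M : ZFSet.{u}) (A : Set M) {n : ℕ}
    (φ : (setLang 1).BoundedFormula Empty n) (v : Fin n → M) : Prop :=
  letI := classStructure M ![A]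
  φ.Realize Empty.elim v

/-- The truth predicate `Tr(A)` relative to `A`: the class of all pairs `(⌜φ⌝, v)` where `φ` is a
formula in the language of `(M, ∈, A)` and `v` a finite tuple from `M` with
`(M, ∈, A) ⊨ φ[v]`. -/
def Tr (M : ZFSet.{u}) (A : Set M) : Set M :=
  {t | ∃ (n : ℕ) (φ : (setLang 1).BoundedFormula Empty n) (v : Fin n → M),
    t.1 = ZFSet.pair (formulaCode φ) (tupleCode v) ∧ Satisfies M A φ v}

/-! ### Cohen-generic classes of ordinals -/

/-- `Add(Ord, 1)` as computed in `M`: the binary sequences in `M` of ordinal length.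
A condition `q` is stronger than `p` when `p ⊆ q`. -/
def AddOrd (M : ZFSet.{u}) : Set M :=
  {p | ∃ α ∈ M, α.IsOrdinal ∧ ZFSet.IsFunc α {∅, {∅}} p.1}

/-- `D` is a dense subclass of `Add(Ord, 1)`. -/
def IsDenseClass (M : ZFSet.{u}) (D : Set M) : Prop :=
  D ⊆ AddOrd M ∧ ∀ p ∈ AddOrd M, ∃ q ∈ D, p.1 ⊆ q.1

/-- The conditions that are initial segments of the characteristic function of `C`. -/
def initialSegments (M : ZFSet.{u}) (C : Set M) : Set M :=
  {p ∈ AddOrd M | ∀ β : M,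
    (ZFSet.pair β.1 {∅} ∈ p.1 → β ∈ C) ∧ (ZFSet.pair β.1 ∅ ∈ p.1 → β ∉ C)}

/-- `C` is a Cohen-generic class of ordinals over `(M, X)`: the initial segments of its
characteristic function meet every dense subclass of `Add(Ord, 1)` that belongs to `X`. -/
def IsCohenGeneric (M : ZFSet.{u}) (X : Set (Set M)) (C : Set M) : Prop :=
  (∀ β ∈ C, β.1.IsOrdinal) ∧
    ∀ D ∈ X, IsDenseClass M D → (initialSegments M C ∩ D).Nonempty

end ClassTheory

/-! The generic class is built so that, together with `T = Tr M A`, it defines a cofinal ω-sequence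
of growth that no closure ordinal survives. Enumerate `M` externally as `a 0, a 1, …`. With `T` as
parameter, every class in `Def M A` has a code in `M` (`exists_codedBy_of_mem_Def`), so meeting the
dense classes coded by the `a n` gives genericity.

Stage `n` starts with a condition `s n`. Zeros are appended until the rank is at least that of `a
n`, giving `p'`; then an extension `r` of `p'` of least rank in the class coded by `a n` is taken,
if one exists; then a single one is appended, giving `s (n + 1)`. The ranks of the `s n` are
unbounded in `M`.

Suppose a GB-expansion contains `C` and `T`. Class replacement then yields a limit `o`, bounded by a
rank in `M`, that is closed under least witnesses for any relation definable from `C` and `T`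
(`ModelsGB.exists_closed`). Take `n` with `s n` of rank below `o` and `s (n + 1)` not. Closure,
applied to "an initial segment of `C` with a one that `s n` lacks", shows that `p'`, and so `a n`,
has rank below `o`, because only zeros separate `s n` from `p'`. Closure, applied to "an initial
segment of `C` extending `p'` in the class coded by `a n`", bounds `r` by minimality. Hence `s (n +
1)` has rank below `o`, a contradiction (`exists_generic_not_closed`). The enumeration never has to
belong to the expansion: `a n` and `p'` enter only as arguments of the relation `Meets`. -/

namespace ClassTheory

open FirstOrder

/-! ### A calculus of definable predicates -/

/-- The predicate `S` of assignments is definable with parameters over `(M, ∈, P₀, …)`. -/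
class Dfn {M : ZFSet.{u}} {k : ℕ} (P : Fin k → Set M) (S : (ℕ → M) → Prop) : Prop where
  out : letI := classStructure M P
    (Set.univ : Set M).Definable (setLang k) {v : ℕ → M | S v}

/-- A function of assignments given by a variable or a parameter. -/
class IsTm {M : ZFSet.{u}} (f : (ℕ → M) → M) : Prop where
  out : (∃ i, ∀ v, f v = v i) ∨ ∃ c, ∀ v, f v = c

section Definability

variable {M : ZFSet.{u}} {k : ℕ} {P : Fin k → Set M}

instance (i : ℕ) : IsTm (fun v : ℕ → M => v i) := ⟨.inl ⟨i, fun _ => rfl⟩⟩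

instance (c : M) : IsTm (fun _ : ℕ → M => c) := ⟨.inr ⟨c, fun _ => rfl⟩⟩

/-- Passing under a quantifier shifts the variables, and a term stays a term under such a renaming.
This is what lets instance search prove definability. -/
instance (priority := low) IsTm.comp (f : (ℕ → M) → M) (g : ℕ → ℕ) [hf : IsTm f] :
    IsTm (fun v => f (fun i => v (g i))) := by
  rcases hf.out with ⟨i, h⟩ | ⟨c, h⟩
  · exact ⟨.inl ⟨g i, fun v => h _⟩⟩
  · exact ⟨.inr ⟨c, fun v => h _⟩⟩

theorem Dfn.congr {S T : (ℕ → M) → Prop} (h : Dfn P S) (e : ∀ v, T v ↔ S v) : Dfn P T := by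
  have : T = S := funext fun v => propext (e v)
  rwa [this]

instance Dfn.and {S T : (ℕ → M) → Prop} [hS : Dfn P S] [hT : Dfn P T] :
    Dfn P (fun v => S v ∧ T v) := by
  let := classStructure M P
  exact ⟨hS.out.inter hT.out⟩

instance Dfn.or {S T : (ℕ → M) → Prop} [hS : Dfn P S] [hT : Dfn P T] :
    Dfn P (fun v => S v ∨ T v) := by
  let := classStructure M P
  exact ⟨hS.out.union hT.out⟩

instance Dfn.not {S : (ℕ → M) → Prop} [hS : Dfn P S] : Dfn P (fun v => ¬ S v) := by
  let := classStructure M P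
  exact ⟨hS.out.compl⟩

instance Dfn.imp {S T : (ℕ → M) → Prop} [Dfn P S] [Dfn P T] :
    Dfn P (fun v => S v → T v) :=
  Dfn.congr (S := fun v => ¬ S v ∨ T v) inferInstance fun _ => imp_iff_not_or

instance Dfn.iff {S T : (ℕ → M) → Prop} [Dfn P S] [Dfn P T] :
    Dfn P (fun v => S v ↔ T v) :=
  Dfn.congr (S := fun v => (S v → T v) ∧ (T v → S v)) inferInstance fun _ => iff_def

instance Dfn.ex {S : (ℕ → M) → M → Prop} [h : Dfn P (fun v => S (fun i => v (i + 1)) (v 0))] :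
    Dfn P (fun v => ∃ x, S v x) := by
  let := classStructure M P
  refine ⟨?_⟩
  -- De Bruijn convention: index 0 is the bound variable and `n + 1` is the old variable `n`. The
  -- quantifier is the projection that forgets the extra coordinate.
  let f : ℕ → ℕ ⊕ Fin 1 := fun n => Nat.casesOn n (.inr 0) .inl
  have h2 := (h.out.preimage_comp f).image_comp_sumInl_fin 1
  refine (congrArg _ ?_).mp h2
  ext v
  constructor
  · rintro ⟨g, hg, rfl⟩
    exact ⟨g (.inr 0), hg⟩
  · rintro ⟨x, hx⟩
    exact ⟨Sum.elim v fun _ => x, hx, rfl⟩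

instance Dfn.all {S : (ℕ → M) → M → Prop} [h : Dfn P (fun v => S (fun i => v (i + 1)) (v 0))] :
    Dfn P (fun v => ∀ x, S v x) :=
  Dfn.congr (S := fun v => ¬ ∃ x, ¬ S v x)
    (@Dfn.not _ _ _ _ (@Dfn.ex _ _ _ (fun v x => ¬ S v x) Dfn.not)) fun _ => by simp

theorem IsTm.exists_var (f : (ℕ → M) → M) [hf : IsTm f] :
    ∃ t : (Set.univ : Set M) ⊕ ℕ, ∀ v, f v = Sum.elim (fun c => c.1) v t := by
  rcases hf.out with ⟨i, h⟩ | ⟨c, h⟩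
  · exact ⟨.inr i, h⟩
  · exact ⟨.inl ⟨c, trivial⟩, h⟩

instance Dfn.eq (f g : (ℕ → M) → M) [IsTm f] [IsTm g] : Dfn P (fun v => f v = g v) := by
  let := classStructure M P
  obtain ⟨s, hs⟩ := IsTm.exists_var f
  obtain ⟨t, ht⟩ := IsTm.exists_var g
  refine ⟨Set.definable_iff_exists_formula_sum.2
    ⟨(Language.Term.var s).equal (Language.Term.var t), ?_⟩⟩
  ext v
  simp only [Set.mem_ofPred_eq, Language.Formula.realize_equal, Language.Term.realize_var, hs, ht]

instance Dfn.mem (f g : (ℕ → M) → M) [IsTm f] [IsTm g] :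
    Dfn P (fun v => (f v).1 ∈ (g v).1) := by
  let := classStructure M P
  obtain ⟨s, hs⟩ := IsTm.exists_var f
  obtain ⟨t, ht⟩ := IsTm.exists_var g
  refine ⟨Set.definable_iff_exists_formula_sum.2
    ⟨Language.Relations.formula (L := setLang k) SetRel.mem
      ![Language.Term.var s, Language.Term.var t], ?_⟩⟩
  ext v
  simp only [Set.mem_ofPred_eq, hs, ht]
  rfl

instance Dfn.cls (i : Fin k) (f : (ℕ → M) → M) [IsTm f] : Dfn P (fun v => f v ∈ P i) := by
  let := classStructure M P
  obtain ⟨s, hs⟩ := IsTm.exists_var f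
  refine ⟨Set.definable_iff_exists_formula_sum.2
    ⟨Language.Relations.formula (L := setLang k) (SetRel.cls i) ![Language.Term.var s], ?_⟩⟩
  ext v
  simp only [Set.mem_ofPred_eq, hs]
  rfl

theorem Dfn.definableFrom {Y : Set M} (h : Dfn P (fun v => v 0 ∈ Y)) : DefinableFrom M P Y := by
  let := classStructure M P
  exact h.out.preimage_comp (fun _ => (0 : Fin 1))

theorem Dfn.definableRelFrom {S : M → M → Prop} (h : Dfn P (fun v => S (v 0) (v 1))) :
    DefinableRelFrom M P {z | S z.1 z.2} := by
  let := classStructure M P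
  exact h.out.preimage_comp (fun n => if n = 0 then (0 : Fin 2) else 1)

/-! ### Basic set-theoretic relations -/

/-- A transitive set that is a model of `ZFC`. -/
class TransModel (M : ZFSet.{u}) : Prop where
  trans : M.IsTransitive
  zfc : ModelsZFC M

theorem eq_iff_val {x y : M} : x = y ↔ x.1 = y.1 := Subtype.ext_iff

theorem mem_of_mem [h : TransModel M] {x : ZFSet.{u}} {y : M} (hx : x ∈ y.1) : x ∈ M :=
  h.trans _ y.2 hx

theorem val_eq_of_forall_mem_iff [TransModel M] {y : M} {x : ZFSet.{u}} (hx : x ⊆ M)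
    (h : ∀ z : M, z.1 ∈ y.1 ↔ z.1 ∈ x) : y.1 = x := by
  ext z
  exact ⟨fun hz => (h ⟨z, mem_of_mem hz⟩).1 hz, fun hz => (h ⟨z, hx hz⟩).2 hz⟩

theorem subset_model [TransModel M] (y : M) : y.1 ⊆ M := fun _ h => mem_of_mem h

theorem sep_mem_model [h : TransModel M] (S : M → Prop)
    [hS : Dfn (![] : Fin 0 → Set M) (fun v => S (v 0))] (a : M) :
    ∃ b : M, ∀ z : M, z.1 ∈ b.1 ↔ z.1 ∈ a.1 ∧ S z :=
  h.zfc.separation {z | S z} (Dfn.definableFrom hS) a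

/-- Restricting the relation to `a` keeps it definable, so single-valuedness is needed only on `a`.
-/
theorem image_mem_model [h : TransModel M] (S : M → M → Prop)
    [hS : Dfn (![] : Fin 0 → Set M) (fun v => S (v 0) (v 1))] (a : M)
    (huniq : ∀ x y y' : M, x.1 ∈ a.1 → S x y → S x y' → y = y') :
    ∃ b : M, ∀ y : M, y.1 ∈ b.1 ↔ ∃ x : M, x.1 ∈ a.1 ∧ S x y := by
  have : Dfn (![] : Fin 0 → Set M) (fun v => (v 0).1 ∈ a.1 ∧ S (v 0) (v 1)) := by
    have : Dfn (![] : Fin 0 → Set M) (fun v => (v 0).1 ∈ a.1) :=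
      Dfn.mem (fun v => v 0) (fun _ => a)
    infer_instance
  obtain ⟨b, hb⟩ := h.zfc.replacement _ (Dfn.definableRelFrom (S := fun x y => x.1 ∈ a.1 ∧ S x y)
    this) (fun x y y' h h' => huniq x y y' h.1 h.2 h'.2) a
  exact ⟨b, fun y => (hb y).trans ⟨fun ⟨x, h1, h2⟩ => ⟨x, h1, h2.2⟩,
    fun ⟨x, h1, h2⟩ => ⟨x, h1, h1, h2⟩⟩⟩

theorem unordered_pair_mem_model [h : TransModel M] {x y : ZFSet.{u}} (hx : x ∈ M) (hy : y ∈ M) :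
    ({x, y} : ZFSet) ∈ M := by
  obtain ⟨z, hz⟩ := h.zfc.pairing ⟨x, hx⟩ ⟨y, hy⟩
  rw [← val_eq_of_forall_mem_iff (y := z) (x := {x, y}) ?_ ?_]
  · exact z.2
  · intro w hw
    rcases ZFSet.mem_pair.1 hw with rfl | rfl <;> assumption
  · simpa using hz

theorem singleton_mem_model [TransModel M] {x : ZFSet.{u}} (hx : x ∈ M) :
    ({x} : ZFSet) ∈ M := by
  simpa using unordered_pair_mem_model hx hx

theorem pair_mem_model [TransModel M] {x y : ZFSet.{u}} (hx : x ∈ M) (hy : y ∈ M) :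
    ZFSet.pair x y ∈ M :=
  unordered_pair_mem_model (singleton_mem_model hx) (unordered_pair_mem_model hx hy)

theorem sUnion_mem_model [h : TransModel M] {x : ZFSet.{u}} (hx : x ∈ M) : ZFSet.sUnion x ∈ M := by
  obtain ⟨u, hu⟩ := h.zfc.union ⟨x, hx⟩
  rw [← val_eq_of_forall_mem_iff (y := u) (x := ZFSet.sUnion x) ?_ ?_]
  · exact u.2
  · intro w hw
    obtain ⟨z, hz, hw⟩ := ZFSet.mem_sUnion.1 hw
    exact h.trans _ (h.trans _ hx hz) hw
  · intro z
    rw [hu, ZFSet.mem_sUnion]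
    exact ⟨fun ⟨y, h1, h2⟩ => ⟨y, h1, h2⟩,
      fun ⟨y, h1, h2⟩ => ⟨⟨y, h.trans _ hx h1⟩, h1, h2⟩⟩

theorem union_mem_model [TransModel M] {x y : ZFSet.{u}} (hx : x ∈ M) (hy : y ∈ M) :
    x ∪ y ∈ M :=
  sUnion_mem_model (unordered_pair_mem_model hx hy)

theorem insert_mem_model [TransModel M] {x y : ZFSet.{u}} (hx : x ∈ M) (hy : y ∈ M) :
    insert x y ∈ M := by
  rw [ZFSet.insert_eq]
  exact union_mem_model (singleton_mem_model hx) hy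

theorem empty_mem_model [h : TransModel M] : (∅ : ZFSet.{u}) ∈ M := by
  obtain ⟨w, ⟨e, -, he⟩, -⟩ := h.zfc.infinity
  rw [← val_eq_of_forall_mem_iff (y := e) (ZFSet.empty_subset _) (by simpa using he)]
  exact e.2

theorem sdiff_mem_model [TransModel M] {x y : ZFSet.{u}} (hx : x ∈ M) (hy : y ∈ M) :
    x \ y ∈ M := by
  obtain ⟨b, hb⟩ := sep_mem_model (fun z => z.1 ∉ (⟨y, hy⟩ : M).1) ⟨x, hx⟩
  rw [← val_eq_of_forall_mem_iff (y := b) (x := x \ y) ?_ ?_]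
  · exact b.2
  · exact fun z hz => subset_model ⟨x, hx⟩ (ZFSet.mem_sdiff.1 hz).1
  · simpa using hb

/-- The empty set as an element of `M`. -/
def zeroM (M : ZFSet.{u}) [TransModel M] : M := ⟨∅, empty_mem_model⟩

/-- The singleton of the empty set as an element of `M`. -/
def oneM (M : ZFSet.{u}) [TransModel M] : M := ⟨{∅}, singleton_mem_model empty_mem_model⟩

/-- The ordered pair as an operation on `M`. -/
def pairM [TransModel M] (x y : M) : M := ⟨ZFSet.pair x.1 y.1, pair_mem_model x.2 y.2⟩

@[simp] theorem zeroM_val [TransModel M] : (zeroM M).1 = ∅ := rfl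
@[simp] theorem oneM_val [TransModel M] : (oneM M).1 = {∅} := rfl
@[simp] theorem pairM_val [TransModel M] (x y : M) : (pairM x y).1 = ZFSet.pair x.1 y.1 := rfl

theorem pairM_inj [TransModel M] {x y x' y' : M} : pairM x y = pairM x' y' ↔ x = x' ∧ y = y' := by
  rw [eq_iff_val]
  simp

theorem subset_iff_forall [TransModel M] {x y : M} :
    x.1 ⊆ y.1 ↔ ∀ z : M, z.1 ∈ x.1 → z.1 ∈ y.1 :=
  ⟨fun h _ hz => h hz, fun h z hz => h ⟨z, mem_of_mem hz⟩ hz⟩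

instance Dfn.subset [TransModel M] (f g : (ℕ → M) → M) [IsTm f] [IsTm g] :
    Dfn P (fun v => (f v).1 ⊆ (g v).1) :=
  Dfn.congr (S := fun v => ∀ z : M, z.1 ∈ (f v).1 → z.1 ∈ (g v).1) inferInstance
    fun _ => subset_iff_forall

theorem eq_pairM_iff [TransModel M] {x y z : M} :
    z = pairM x y ↔ ∀ w : M, w.1 ∈ z.1 ↔ (∀ t : M, t.1 ∈ w.1 ↔ t = x) ∨
      (∀ t : M, t.1 ∈ w.1 ↔ t = x ∨ t = y) := by
  have key : ∀ w : M, w.1 ∈ ZFSet.pair x.1 y.1 ↔ (∀ t : M, t.1 ∈ w.1 ↔ t = x) ∨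
      (∀ t : M, t.1 ∈ w.1 ↔ t = x ∨ t = y) := by
    intro w
    rw [ZFSet.pair, ZFSet.mem_pair]
    refine or_congr ⟨fun h t => by simp [h], fun h => ?_⟩
      ⟨fun h t => by simp [h], fun h => ?_⟩
    · refine val_eq_of_forall_mem_iff ?_ (by simpa using h)
      exact subset_model ⟨_, singleton_mem_model x.2⟩
    · refine val_eq_of_forall_mem_iff ?_ (by simpa using h)
      exact subset_model ⟨_, unordered_pair_mem_model x.2 y.2⟩
  constructor
  · rintro rfl
    exact key
  · intro h
    refine Subtype.ext (val_eq_of_forall_mem_iff (subset_model (pairM x y)) fun w => ?_)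
    rw [h, pairM_val, key]

instance Dfn.eq_pairM [TransModel M] (f g h : (ℕ → M) → M) [IsTm f] [IsTm g] [IsTm h] :
    Dfn P (fun v => f v = pairM (g v) (h v)) :=
  Dfn.congr (S := fun v => ∀ w : M, w.1 ∈ (f v).1 ↔ (∀ t : M, t.1 ∈ w.1 ↔ t = g v) ∨
      (∀ t : M, t.1 ∈ w.1 ↔ t = g v ∨ t = h v)) inferInstance fun _ => eq_pairM_iff

instance Dfn.pairM_mem [TransModel M] (f g h : (ℕ → M) → M) [IsTm f] [IsTm g] [IsTm h] :
    Dfn P (fun v => (pairM (g v) (h v)).1 ∈ (f v).1) :=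
  Dfn.congr (S := fun v => ∃ z : M, z = pairM (g v) (h v) ∧ z.1 ∈ (f v).1) inferInstance
    fun _ => by simp

instance Dfn.isOrdinal [TransModel M] (f : (ℕ → M) → M) [IsTm f] :
    Dfn P (fun v => (f v).1.IsOrdinal) :=
  Dfn.congr (S := fun v => (∀ y : M, y.1 ∈ (f v).1 → y.1 ⊆ (f v).1) ∧
      ∀ y : M, y.1 ∈ (f v).1 → ∀ z : M, z.1 ∈ y.1 → z.1 ⊆ y.1) inferInstance fun v => by
    rw [ZFSet.isOrdinal_iff_forall_mem_isTransitive]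
    refine and_congr ⟨fun h y hy => h _ hy, fun h y hy => h ⟨y, mem_of_mem hy⟩ hy⟩
      ⟨fun h y hy z hz => h _ hy _ hz, fun h y hy z hz => ?_⟩
    have hy' : y ∈ M := mem_of_mem hy
    exact h ⟨y, hy'⟩ hy ⟨z, mem_of_mem (y := ⟨y, hy'⟩) hz⟩ hz

end Definability

/-! ### Ranks in a transitive model -/

section Ranks

variable {M : ZFSet.{u}} {k : ℕ} {P : Fin k → Set M}

/-- The elements of `M` of rank below `o`. -/
noncomputable def lowRank (M : ZFSet.{u}) (o : Ordinal.{u}) : ZFSet.{u} :=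
  ZFSet.sep (fun x => x.rank < o) M

theorem mem_lowRank {o : Ordinal.{u}} {x : ZFSet.{u}} :
    x ∈ lowRank M o ↔ x ∈ M ∧ x.rank < o := ZFSet.mem_sep

theorem rank_lowRank_le (o : Ordinal.{u}) : (lowRank M o).rank ≤ o :=
  ZFSet.rank_le_iff.2 fun _ h => (mem_lowRank.1 h).2

/-- The set `h` is a history: each of its members is the set of all subsets of earlier members. -/
def IsHistory (h : M) : Prop :=
  ∀ v : M, v.1 ∈ h.1 → ∀ z : M, z.1 ∈ v.1 ↔ ∃ w : M, w.1 ∈ h.1 ∧ w.1 ∈ v.1 ∧ z.1 ⊆ w.1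

/-- The set `v` is a level of the cumulative hierarchy of `M`. -/
def IsLevel (v : M) : Prop :=
  ∃ h : M, IsHistory h ∧ ∀ z : M, z.1 ∈ v.1 ↔ ∃ w : M, w.1 ∈ h.1 ∧ z.1 ⊆ w.1

variable [TransModel M]

instance Dfn.isHistory (f : (ℕ → M) → M) [IsTm f] : Dfn P (fun v => IsHistory (f v)) := by
  unfold IsHistory
  infer_instance

instance Dfn.isLevel (f : (ℕ → M) → M) [IsTm f] : Dfn P (fun v => IsLevel (f v)) := by
  unfold IsLevel
  infer_instance

/-- The set `v` is closed under passing to sets in `M` of smaller or equal rank. -/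
def RankClosed (v : M) : Prop :=
  ∀ z y : M, z.1 ∈ v.1 → y.1.rank ≤ z.1.rank → y.1 ∈ v.1

theorem subset_of_rank_le {v y z : M} (hv : RankClosed v) (hz : z.1 ⊆ v.1)
    (h : y.1.rank ≤ z.1.rank) : y.1 ⊆ v.1 := by
  refine subset_iff_forall.2 fun t ht => ?_
  obtain ⟨s, hs, hts⟩ := ZFSet.lt_rank_iff.1 ((ZFSet.rank_lt_of_mem ht).trans_le h)
  exact hv ⟨s, mem_of_mem hs⟩ t (hz hs) hts

/-- By ∈-induction on members: each is the union of the power sets of the members inside it, and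
power sets preserve closure under smaller rank. -/
theorem IsHistory.rankClosed {h : M} (hh : IsHistory h) (v : M) (hv : v.1 ∈ h.1) :
    RankClosed v := by
  obtain ⟨v, hvM⟩ := v
  induction v using ZFSet.inductionOn with
  | h v ih =>
    intro z y hz hy
    obtain ⟨w, hw, hwv, hzw⟩ := (hh _ hv z).1 hz
    exact (hh _ hv y).2 ⟨w, hw, hwv, subset_of_rank_le (ih _ hwv w.2 hw) hzw hy⟩

theorem IsLevel.rankClosed {v : M} (hv : IsLevel v) : RankClosed v := by
  obtain ⟨h, hh, hv⟩ := hv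
  intro z y hz hy
  obtain ⟨w, hw, hzw⟩ := (hv z).1 hz
  exact (hv y).2 ⟨w, hw, subset_of_rank_le (hh.rankClosed w hw) hzw hy⟩

/-- An element of rank at least that of `y` would force `y` into `v`; anything of smaller rank is
dominated by an element of `y`, which lies in `v`. So levels can be pinned down by a first-order
condition on `y`. -/
theorem RankClosed.eq_lowRank {v y : M} (hv : RankClosed v) (hy : y.1 ⊆ v.1) (hy' : y.1 ∉ v.1) :
    v.1 = lowRank M y.1.rank := by
  ext z
  rw [mem_lowRank]
  constructor
  · intro hz
    have hzM : z ∈ M := mem_of_mem hz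
    exact ⟨hzM, lt_of_not_ge fun h => hy' (hv ⟨z, hzM⟩ y hz h)⟩
  · rintro ⟨hzM, hz⟩
    obtain ⟨s, hs, hzs⟩ := ZFSet.lt_rank_iff.1 hz
    exact hv ⟨s, mem_of_mem hs⟩ ⟨z, hzM⟩ (hy hs) hzs

theorem RankClosed.eq_lowRank_self {v : M} (hv : RankClosed v) : v.1 = lowRank M v.1.rank :=
  hv.eq_lowRank (fun _ h => h) (ZFSet.mem_irrefl _)

theorem exists_rank_eq {o : Ordinal.{u}} (x : M) (h : o ≤ x.1.rank) : ∃ y : M, y.1.rank = o := by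
  obtain ⟨x, hx⟩ := x
  induction x using ZFSet.inductionOn with
  | h x ih =>
    rcases h.eq_or_lt with h | h
    · exact ⟨⟨x, hx⟩, h.symm⟩
    · obtain ⟨y, hy, h⟩ := ZFSet.lt_rank_iff.1 h
      exact ih y hy (mem_of_mem (y := ⟨x, hx⟩) hy) h

/-- The set `h` consists of the sets `lowRank M p` for `p < o`. -/
def IsLowRanks (o : Ordinal.{u}) (h : M) : Prop :=
  ∀ w, w ∈ h.1 ↔ ∃ p < o, w = lowRank M p

theorem powerset_mem_model (x : M) : ∃ p : M, ∀ z : M, z.1 ∈ p.1 ↔ z.1 ⊆ x.1 := by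
  obtain ⟨p, hp⟩ := TransModel.zfc.powerset x
  exact ⟨p, fun z => (hp z).trans subset_iff_forall.symm⟩

theorem IsLowRanks.mem_lowRank_iff {o : Ordinal.{u}} {h : M} (hh : IsLowRanks o h) (z : M) :
    z.1 ∈ lowRank M o ↔ ∃ w : M, w.1 ∈ h.1 ∧ z.1 ⊆ w.1 := by
  rw [mem_lowRank]
  constructor
  · rintro ⟨-, hz⟩
    have hw : lowRank M z.1.rank ∈ h.1 := (hh _).2 ⟨_, hz, rfl⟩
    exact ⟨⟨_, mem_of_mem hw⟩, hw,
      fun t ht => mem_lowRank.2 ⟨mem_of_mem ht, ZFSet.rank_lt_of_mem ht⟩⟩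
  · rintro ⟨w, hw, hzw⟩
    obtain ⟨p, hp, hwp⟩ := (hh _).1 hw
    rw [hwp] at hzw
    exact ⟨z.2, ((ZFSet.rank_mono hzw).trans (rank_lowRank_le p)).trans_lt hp⟩

theorem IsLowRanks.lowRank_mem {o : Ordinal.{u}} {h : M} (hh : IsLowRanks o h) :
    lowRank M o ∈ M := by
  obtain ⟨p, hp⟩ := powerset_mem_model ⟨_, sUnion_mem_model h.2⟩
  obtain ⟨b, hb⟩ := sep_mem_model (fun z => ∃ w : M, w.1 ∈ h.1 ∧ z.1 ⊆ w.1) p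
  rw [← val_eq_of_forall_mem_iff (y := b) (x := lowRank M o) ?_ ?_]
  · exact b.2
  · exact fun z hz => (mem_lowRank.1 hz).1
  · intro z
    rw [hb, hp, hh.mem_lowRank_iff]
    exact ⟨And.right, fun ⟨w, hw, hz⟩ =>
      ⟨fun t ht => ZFSet.mem_sUnion.2 ⟨w.1, hw, hz ht⟩, w, hw, hz⟩⟩

theorem IsLowRanks.isHistory {o : Ordinal.{u}} {h : M} (hh : IsLowRanks o h) : IsHistory h := by
  intro v hv z
  obtain ⟨p, hp, hvp⟩ := (hh _).1 hv
  rw [hvp]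
  constructor
  · intro hz
    have hzp := (mem_lowRank.1 hz).2
    have hw : lowRank M z.1.rank ∈ h.1 := (hh _).2 ⟨_, hzp.trans hp, rfl⟩
    exact ⟨⟨_, mem_of_mem hw⟩, hw, mem_lowRank.2
      ⟨mem_of_mem hw, (rank_lowRank_le _).trans_lt hzp⟩,
      fun t ht => mem_lowRank.2 ⟨mem_of_mem ht, ZFSet.rank_lt_of_mem ht⟩⟩
  · rintro ⟨w, -, hwp, hzw⟩
    exact mem_lowRank.2 ⟨z.2, (ZFSet.rank_mono hzw).trans_lt (mem_lowRank.1 hwp).2⟩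

theorem IsLowRanks.isLevel {o : Ordinal.{u}} {h : M} (hh : IsLowRanks o h) :
    IsLevel ⟨lowRank M o, hh.lowRank_mem⟩ :=
  ⟨h, hh.isHistory, hh.mem_lowRank_iff⟩

/-- Induction on rank, carrying out the construction of the cumulative hierarchy inside `M`. -/
theorem exists_isLowRanks (x : M) : ∃ h : M, IsLowRanks x.1.rank h := by
  suffices ∀ o : Ordinal.{u}, ∀ x : M, x.1.rank = o → ∃ h : M, IsLowRanks o h from this _ x rfl
  intro o
  induction o using WellFoundedLT.induction with
  | ind o ih =>
    intro x hx
    have hlow : ∀ y : M, y.1 ∈ x.1 → ∃ hM : lowRank M y.1.rank ∈ M,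
        IsLevel (⟨lowRank M y.1.rank, hM⟩ : M) := fun y hy => by
      obtain ⟨h, hh⟩ := ih _ (hx ▸ ZFSet.rank_lt_of_mem hy) y rfl
      exact ⟨hh.lowRank_mem, hh.isLevel⟩
    -- The only level that includes `y` without containing it is `lowRank M y.1.rank`, so
    -- Replacement collects these levels.
    obtain ⟨b, hb⟩ := image_mem_model (fun y v => IsLevel v ∧ y.1 ⊆ v.1 ∧ y.1 ∉ v.1) x
      (fun y v v' _ h h' => Subtype.ext <|
        (h.1.rankClosed.eq_lowRank h.2.1 h.2.2).trans
          (h'.1.rankClosed.eq_lowRank h'.2.1 h'.2.2).symm)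
    have hb' : ∀ w : M, w.1 ∈ b.1 ↔ ∃ y : M, y.1 ∈ x.1 ∧ w.1 = lowRank M y.1.rank := by
      intro w
      rw [hb]
      constructor
      · rintro ⟨y, hy, h1, h2, h3⟩
        exact ⟨y, hy, h1.rankClosed.eq_lowRank h2 h3⟩
      · rintro ⟨y, hy, hw⟩
        obtain ⟨hM, hl⟩ := hlow y hy
        obtain rfl : w = ⟨_, hM⟩ := Subtype.ext hw
        exact ⟨y, hy, hl, fun t ht => mem_lowRank.2 ⟨mem_of_mem ht, ZFSet.rank_lt_of_mem ht⟩,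
          fun h => lt_irrefl _ (mem_lowRank.1 h).2⟩
    -- The ranks of elements of `x` may skip ordinals; the missing lower levels are elements of the
    -- collected ones, whence the union.
    obtain ⟨h, hh⟩ := sep_mem_model (fun w => IsLevel w)
      ⟨b.1 ∪ ZFSet.sUnion b.1, union_mem_model b.2 (sUnion_mem_model b.2)⟩
    refine ⟨h, fun w => ⟨fun hw => ?_, ?_⟩⟩
    · have hwM : w ∈ M := mem_of_mem hw
      obtain ⟨h1, h2⟩ := (hh ⟨w, hwM⟩).1 hw
      refine ⟨w.rank, ?_, h2.rankClosed.eq_lowRank_self⟩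
      rcases ZFSet.mem_union.1 h1 with h1 | h1
      · obtain ⟨y, hy, hwy⟩ := (hb' ⟨w, hwM⟩).1 h1
        change w = _ at hwy
        rw [hwy, ← hx]
        exact (rank_lowRank_le _).trans_lt (ZFSet.rank_lt_of_mem hy)
      · obtain ⟨v, hv, hwv⟩ := ZFSet.mem_sUnion.1 h1
        obtain ⟨y, hy, hvy⟩ := (hb' ⟨v, mem_of_mem hv⟩).1 hv
        change v = _ at hvy
        rw [hvy] at hwv
        rw [← hx]
        exact (mem_lowRank.1 hwv).2.trans (ZFSet.rank_lt_of_mem hy)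
    · rintro ⟨p, hp, rfl⟩
      rw [← hx] at hp
      obtain ⟨y, hy, hpy⟩ := ZFSet.lt_rank_iff.1 hp
      have hyM : y ∈ M := mem_of_mem hy
      obtain ⟨z, rfl⟩ := exists_rank_eq ⟨y, hyM⟩ hpy
      obtain ⟨hs, hhs⟩ := ih _ (hx ▸ hp) z rfl
      refine (hh ⟨_, hhs.lowRank_mem⟩).2 ⟨ZFSet.mem_union.2 ?_, hhs.isLevel⟩
      rcases hpy.eq_or_lt with h | h
      · exact .inl ((hb' ⟨_, hhs.lowRank_mem⟩).2 ⟨⟨y, hyM⟩, hy, congrArg (lowRank M) h⟩)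
      · obtain ⟨hM, -⟩ := hlow ⟨y, hyM⟩ hy
        exact .inr (ZFSet.mem_sUnion.2 ⟨_, (hb' ⟨_, hM⟩).2 ⟨⟨y, hyM⟩, hy, rfl⟩,
          mem_lowRank.2 ⟨hhs.lowRank_mem, (rank_lowRank_le _).trans_lt h⟩⟩)

theorem lowRank_mem (x : M) : lowRank M x.1.rank ∈ M := by
  obtain ⟨h, hh⟩ := exists_isLowRanks x
  exact hh.lowRank_mem

/-- This turns comparison of true ranks into a first-order statement over `M`. -/
theorem rank_lt_rank_iff {x y : M} :
    x.1.rank < y.1.rank ↔ ∃ v : M, IsLevel v ∧ x.1 ∈ v.1 ∧ y.1 ∉ v.1 := by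
  constructor
  · intro hxy
    -- The rank of the singleton is the successor of the rank of `x`, so its level contains `x` but
    -- nothing of larger rank.
    obtain ⟨h, hh⟩ := exists_isLowRanks (⟨{x.1}, singleton_mem_model x.2⟩ : M)
    refine ⟨_, hh.isLevel, mem_lowRank.2 ⟨x.2, ?_⟩, fun hy => ?_⟩
    · simp
    · have := (mem_lowRank.1 hy).2
      simp only [ZFSet.rank_singleton, Order.lt_succ_iff] at this
      exact this.not_gt hxy
  · rintro ⟨v, hv, hx, hy⟩
    exact lt_of_not_ge fun h => hy (hv.rankClosed x y hx h)

instance Dfn.rank_lt (f g : (ℕ → M) → M) [IsTm f] [IsTm g] :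
    Dfn P (fun v => (f v).1.rank < (g v).1.rank) :=
  Dfn.congr (S := fun v => ∃ u : M, IsLevel u ∧ (f v).1 ∈ u.1 ∧ (g v).1 ∉ u.1) inferInstance
    fun _ => rank_lt_rank_iff

theorem toZFSet_mem_model {o : Ordinal.{u}} (x : M) (h : o ≤ x.1.rank) : o.toZFSet ∈ M := by
  obtain ⟨y, rfl⟩ := exists_rank_eq x h
  clear h x
  suffices ∀ o : Ordinal.{u}, ∀ y : M, y.1.rank = o → o.toZFSet ∈ M from this _ y rfl
  intro o
  induction o using WellFoundedLT.induction with
  | ind o ih =>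
    rintro y rfl
    obtain ⟨b, hb⟩ := sep_mem_model (fun z => z.1.IsOrdinal) ⟨_, lowRank_mem y⟩
    rw [← val_eq_of_forall_mem_iff (y := b) (x := y.1.rank.toZFSet) ?_ ?_]
    · exact b.2
    · intro z hz
      obtain ⟨p, hp, rfl⟩ := Ordinal.mem_toZFSet_iff.1 hz
      obtain ⟨w, hw⟩ := exists_rank_eq y hp.le
      exact ih p hp w hw
    · intro z
      rw [hb, mem_lowRank, Ordinal.mem_toZFSet_iff]
      constructor
      · rintro ⟨⟨-, h1⟩, h2⟩
        exact ⟨_, h1, h2.toZFSet_rank_eq⟩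
      · rintro ⟨p, hp, h⟩
        rw [← h]
        exact ⟨⟨h ▸ z.2, by simpa using hp⟩, ZFSet.isOrdinal_toZFSet p⟩

end Ranks

/-! ### Closure ordinals from class replacement -/

section Closure

variable {M : ZFSet.{u}} {k : ℕ} {P : Fin k → Set M}

theorem exists_min_rank {S : M → Prop} (h : ∃ x, S x) :
    ∃ x, S x ∧ ∀ y, S y → x.1.rank ≤ y.1.rank := by
  obtain ⟨x, hx, hmin⟩ := (InvImage.wf (fun x : M => x.1.rank) wellFounded_lt).has_min {x | S x} h
  exact ⟨x, hx, fun y hy => not_lt.1 (hmin y hy)⟩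

theorem rank_eq_iff_not_lt {x y : M} :
    x.1.rank = y.1.rank ↔ ¬ x.1.rank < y.1.rank ∧ ¬ y.1.rank < x.1.rank := by
  rw [not_lt, not_lt, le_antisymm_iff, and_comm]

/-- The binary relation `S` is definable with parameters over `(M, ∈, P₀, …)`. -/
class DfnRel (P : Fin k → Set M) (S : M → M → Prop) : Prop where
  out : ∀ f g, [IsTm f] → [IsTm g] → Dfn P (fun v => S (f v) (g v))

/-- Whatever is `Q`-related to a set of rank below `c` is so by a witness of rank below `d`. -/
def Closes (Q : M → M → Prop) (c d : M) : Prop :=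
  c.1.rank < d.1.rank ∧ ∀ x r : M, x.1.rank < c.1.rank → Q x r →
    ∃ r' : M, r'.1.rank < d.1.rank ∧ Q x r'

/-- The ordinal `d` is least such that `Closes Q c d`. -/
def ClosesLeast (Q : M → M → Prop) (c d : M) : Prop :=
  d.1.IsOrdinal ∧ Closes Q c d ∧ ∀ d' : M, d'.1.rank < d.1.rank → ¬ Closes Q c d'

theorem ClosesLeast.unique {Q : M → M → Prop} {c d e : M} (hd : ClosesLeast Q c d)
    (he : ClosesLeast Q c e) : d = e :=
  Subtype.ext <| (hd.1.rank_inj he.1).1 <|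
    (not_lt.1 fun h => hd.2.2 e h he.2.1).antisymm (not_lt.1 fun h => he.2.2 d h hd.2.1)

/-- The set `j` is the successor of `i`. -/
def IsSucc (i j : M) : Prop := ∀ t : M, t.1 ∈ j.1 ↔ t.1 ∈ i.1 ∨ t = i

variable [TransModel M]

/-- The pair `(i, d)` is the last member of a finite sequence of iterations of `N`
starting with `∅`. -/
def IterRel (N : M → M → Prop) (i d : M) : Prop :=
  ∃ s : M, (pairM i d).1 ∈ s.1 ∧ ∀ z : M, z.1 ∈ s.1 → z = pairM (zeroM M) (zeroM M) ∨
    ∃ i₀ d₀ j e : M, (pairM i₀ d₀).1 ∈ s.1 ∧ IsSucc i₀ j ∧ N d₀ e ∧ z = pairM j e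

/-- Comprehension makes the relation restricted to `a` a class of ordered pairs, to which class
replacement applies. -/
theorem ModelsGB.image_mem {X : Set (Set M)} (hX : ModelsGB M X) (hP : ∀ i, P i ∈ X)
    {S : M → M → Prop} (hS : DfnRel P S) (a : M)
    (huniq : ∀ x y y' : M, x.1 ∈ a.1 → S x y → S x y' → y = y') :
    ∃ b : M, ∀ y : M, y.1 ∈ b.1 ↔ ∃ x : M, x.1 ∈ a.1 ∧ S x y := by
  have := hS.out
  let F : Set M := {z | ∃ x y : M, z = pairM x y ∧ x.1 ∈ a.1 ∧ S x y}
  have hF : F ∈ X := by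
    refine hX.comprehension k P hP F (Dfn.definableFrom ?_)
    change Dfn P (fun v => ∃ x y : M, v 0 = pairM x y ∧ x.1 ∈ a.1 ∧ S x y)
    have : ∀ f : (ℕ → M) → M, [IsTm f] → Dfn P (fun v => (f v).1 ∈ a.1) :=
      fun f _ => Dfn.mem f (fun _ => a)
    infer_instance
  have hmem : ∀ x y, PairMem F x y ↔ x.1 ∈ a.1 ∧ S x y := by
    intro x y
    constructor
    · rintro ⟨p, ⟨x', y', rfl, h⟩, hp⟩
      obtain ⟨rfl, rfl⟩ := pairM_inj.1 (Subtype.ext hp : pairM x' y' = pairM x y)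
      exact h
    · exact fun h => ⟨pairM x y, ⟨x, y, rfl, h⟩, rfl⟩
  obtain ⟨b, hb⟩ := hX.class_replacement F hF
    ⟨fun p ⟨x, y, hp, _⟩ => ⟨x, y, congrArg Subtype.val hp⟩, fun x y y' h h' =>
      huniq x y y' ((hmem _ _).1 h).1 ((hmem _ _).1 h).2 ((hmem _ _).1 h').2⟩ a
  refine ⟨b, fun y => (hb y).trans ?_⟩
  simp only [hmem, and_self_left]

instance Dfn.rank_eq (f g : (ℕ → M) → M) [IsTm f] [IsTm g] :
    Dfn P (fun v => (f v).1.rank = (g v).1.rank) :=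
  Dfn.congr (S := fun v => ¬ (f v).1.rank < (g v).1.rank ∧ ¬ (g v).1.rank < (f v).1.rank)
    inferInstance fun _ => rank_eq_iff_not_lt

instance Dfn.closes (Q : M → M → Prop)
    [hQ : DfnRel P Q]
    (f g : (ℕ → M) → M) [IsTm f] [IsTm g] : Dfn P (fun v => Closes Q (f v) (g v)) := by
  unfold Closes
  have := hQ.out
  infer_instance

instance DfnRel.closesLeast (Q : M → M → Prop) [DfnRel P Q] : DfnRel P (ClosesLeast Q) := by
  refine ⟨fun f g _ _ => ?_⟩
  unfold ClosesLeast
  infer_instance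

instance Dfn.isSucc (f g : (ℕ → M) → M) [IsTm f] [IsTm g] :
    Dfn P (fun v => IsSucc (f v) (g v)) := by
  unfold IsSucc
  infer_instance

instance DfnRel.iterRel (N : M → M → Prop) [hN : DfnRel P N] : DfnRel P (IterRel N) := by
  refine ⟨fun f g _ _ => ?_⟩
  unfold IterRel
  have := hN.out
  have : ∀ f : (ℕ → M) → M, [IsTm f] → Dfn P (fun v => f v = pairM (zeroM M) (zeroM M)) :=
    fun f _ => Dfn.eq f (fun _ => _)
  infer_instance

theorem isSucc_iff {i j : M} : IsSucc i j ↔ j.1 = insert i.1 i.1 := by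
  constructor
  · intro h
    refine val_eq_of_forall_mem_iff (subset_model ⟨_, insert_mem_model i.2 i.2⟩) fun z => ?_
    rw [h, ZFSet.mem_insert_iff, or_comm, eq_iff_val]
  · intro h t
    rw [h, ZFSet.mem_insert_iff, or_comm, eq_iff_val]

theorem natCode_succ (n : ℕ) : natCode.{u} (n + 1) = insert (natCode n) (natCode n) := by
  simp [natCode]

theorem natCode_injective : Function.Injective natCode.{u} := fun m n h => by
  simpa using Ordinal.toZFSet_injective h

theorem natCode_mem_model (n : ℕ) : natCode n ∈ M := by
  induction n with
  | zero => simpa [natCode] using empty_mem_model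
  | succ n ih =>
    rw [natCode_succ]
    exact insert_mem_model ih ih

theorem exists_natCode_mem : ∃ w : M, ∀ n, natCode n ∈ w.1 := by
  obtain ⟨w, ⟨e, hew, he⟩, hw⟩ := (TransModel.zfc (M := M)).infinity
  refine ⟨w, fun n => ?_⟩
  induction n with
  | zero =>
    have := val_eq_of_forall_mem_iff (y := e) (ZFSet.empty_subset _) (by simpa using he)
    simpa [natCode, ← this] using hew
  | succ n ih =>
    obtain ⟨y, hy, h⟩ := hw ⟨_, natCode_mem_model n⟩ ih
    rw [natCode_succ, ← isSucc_iff.1 h]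
    exact hy

/-- Send each `x` of rank below `c` to the least rank of a witness. This is an ordinal, so no global
choice is needed; replacement bounds these ordinals. -/
theorem ModelsGB.exists_closesLeast {X : Set (Set M)} (hX : ModelsGB M X) (hP : ∀ i, P i ∈ X)
    (Q : M → M → Prop) [hQ : DfnRel P Q] (c : M) :
    ∃ d, ClosesLeast Q c d := by
  have hex : ∃ d, Closes Q c d := by
    have := hQ.out
    obtain ⟨b, hb⟩ := hX.image_mem hP (S := fun x d => d.1.IsOrdinal ∧
      (∃ r, Q x r ∧ r.1.rank = d.1.rank) ∧ ∀ r, Q x r → ¬ r.1.rank < d.1.rank)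
      ⟨fun f g _ _ => inferInstance⟩ ⟨_, lowRank_mem c⟩ <| by
      rintro x d e - ⟨hd, ⟨r, hr, hrd⟩, hd'⟩ ⟨he, ⟨t, ht, hte⟩, he'⟩
      refine Subtype.ext ((hd.rank_inj he).1 ?_)
      have h1 := hd' t ht
      have h2 := he' r hr
      rw [hte] at h1
      rw [hrd] at h2
      exact (not_lt.1 h1).antisymm (not_lt.1 h2)
    refine ⟨⟨insert c.1 b.1, insert_mem_model c.2 b.2⟩,
      ZFSet.rank_lt_of_mem (ZFSet.mem_insert _ _), fun x r hx hr => ?_⟩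
    obtain ⟨r', hr', hmin⟩ := exists_min_rank (S := Q x) ⟨r, hr⟩
    refine ⟨r', ?_, hr'⟩
    have hd : (⟨_, toZFSet_mem_model r' le_rfl⟩ : M).1 ∈ b.1 :=
      (hb _).2 ⟨x, mem_lowRank.2 ⟨x.2, hx⟩, ZFSet.isOrdinal_toZFSet _,
        ⟨r', hr', by simp⟩, fun t ht => by simpa using hmin t ht⟩
    simpa using ZFSet.rank_lt_of_mem (ZFSet.mem_insert_of_mem c.1 hd)
  obtain ⟨d, hd, hmin⟩ := exists_min_rank hex
  refine ⟨⟨_, toZFSet_mem_model d le_rfl⟩, ZFSet.isOrdinal_toZFSet _, ?_, fun d' hd' h => ?_⟩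
  · simpa [Closes] using hd
  · exact (hmin d' h).not_gt (by simpa using hd')

/-- Iterate the least closing ordinal ω times from `∅` and take the supremum `o`. The iteration is
definable through finite approximations, so replacement keeps `o` bounded in `M`. -/
theorem ModelsGB.exists_closed {X : Set (Set M)} (hX : ModelsGB M X) (hP : ∀ i, P i ∈ X)
    (Q : M → M → Prop) [hQ : DfnRel P Q] :
    ∃ o : Ordinal.{u}, 0 < o ∧ (∀ p < o, Order.succ p < o) ∧ (∃ y : M, o ≤ y.1.rank) ∧
      ∀ x r : M, x.1.rank < o → Q x r → ∃ r' : M, r'.1.rank < o ∧ Q x r' := by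
  choose N hN using hX.exists_closesLeast (P := P) hP Q
  let c : ℕ → M := fun n => N^[n] (zeroM M)
  have hc : ∀ n, ClosesLeast Q (c n) (c (n + 1)) := fun n => by
    simp only [c, Function.iterate_succ_apply']
    exact hN _
  let ν : ℕ → M := fun n => ⟨natCode n, natCode_mem_model n⟩
  have hν : ∀ n, IsSucc (ν n) (ν (n + 1)) := fun n => isSucc_iff.2 (natCode_succ n)
  have hν0 : ν 0 = zeroM M := Subtype.ext (by simp [ν, natCode])
  have hiter : ∀ n, IterRel (ClosesLeast Q) (ν n) (c n) := by
    intro n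
    induction n with
    | zero =>
      exact ⟨⟨_, singleton_mem_model (pairM (ν 0) (c 0)).2⟩, ZFSet.mem_singleton.2 rfl,
        fun z hz => .inl ((Subtype.ext (ZFSet.mem_singleton.1 hz)).trans
          (pairM_inj.2 ⟨hν0, rfl⟩))⟩
    | succ n ih =>
      obtain ⟨s, hs, hs'⟩ := ih
      refine ⟨⟨_, insert_mem_model (pairM (ν (n + 1)) (c (n + 1))).2 s.2⟩,
        ZFSet.mem_insert _ _, fun z hz => ?_⟩
      rcases ZFSet.mem_insert_iff.1 hz with hz | hz
      · exact .inr ⟨ν n, c n, _, _, ZFSet.mem_insert_of_mem _ hs, hν n, hc n, Subtype.ext hz⟩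
      · rcases hs' z hz with h | ⟨i, d, j, e, h, h'⟩
        · exact .inl h
        · exact .inr ⟨i, d, j, e, ZFSet.mem_insert_of_mem _ h, h'⟩
  -- An approximation is an arbitrary set in `M`, but its clauses descend along successors, so
  -- ∈-induction on `i` and uniqueness of the least closing ordinal identify every pair in it.
  have hiter' : ∀ i d, IterRel (ClosesLeast Q) i d → ∃ n, i = ν n ∧ d = c n := by
    rintro ⟨i, hi⟩ d ⟨s, hs, hs'⟩
    induction i using ZFSet.inductionOn generalizing d with
    | h i ih =>
      rcases hs' _ hs with h | ⟨i₀, d₀, j, e, h, hj, he, hz⟩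
      · rw [pairM_inj] at h
        exact ⟨0, h.1.trans hν0.symm, h.2⟩
      · obtain ⟨rfl, rfl⟩ := pairM_inj.1 hz
        have hij := isSucc_iff.1 hj
        obtain ⟨n, h1, rfl⟩ := ih i₀.1 ((hj i₀).2 (.inr rfl)) i₀.2 d₀ h
        refine ⟨n + 1, Subtype.ext ?_, he.unique (hc n)⟩
        rw [hij, isSucc_iff.1 (hν n), ← h1]
  obtain ⟨w, hw⟩ := exists_natCode_mem (M := M)
  -- The set `w` may have members other than the naturals; these are related to nothing.
  obtain ⟨b, hb⟩ := hX.image_mem hP (DfnRel.iterRel (ClosesLeast Q)) w <| by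
    intro i d e _ hd he
    obtain ⟨m, hm, rfl⟩ := hiter' i d hd
    obtain ⟨n, hn, rfl⟩ := hiter' i e he
    rw [natCode_injective (congrArg Subtype.val (hm.symm.trans hn) : natCode m = natCode n)]
  have hcb : ∀ n, (c n).1.rank ≤ b.1.rank := fun n =>
    (ZFSet.rank_lt_of_mem ((hb _).2 ⟨ν n, hw n, hiter n⟩)).le
  have hlt : ∀ p, p < ⨆ n, (c n).1.rank ↔ ∃ n, p < (c n).1.rank := fun p => Ordinal.lt_iSup_iff
  refine ⟨⨆ n, (c n).1.rank, ?_, fun p hp => ?_, ⟨b, Ordinal.iSup_le hcb⟩, fun x r hx hr => ?_⟩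
  · exact (hlt _).2 ⟨1, bot_le.trans_lt (hc 0).2.1.1⟩
  · obtain ⟨n, hn⟩ := (hlt _).1 hp
    exact (hlt _).2 ⟨n + 1, (Order.succ_le_of_lt hn).trans_lt (hc n).2.1.1⟩
  · obtain ⟨n, hn⟩ := (hlt _).1 hx
    obtain ⟨r', h1, h2⟩ := (hc n).2.1.2 x r hn hr
    exact ⟨r', (hlt _).2 ⟨n + 1, h1⟩, h2⟩

end Closure

/-! ### A universal relation for the classes in `Def(M, A)` -/

section Truth

/-! ### Unique readability of codes -/

theorem natCode_inj {m n : ℕ} : natCode.{u} m = natCode n ↔ m = n := natCode_injective.eq_iff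

theorem varIndex_injective {k n : ℕ} :
    Function.Injective (varIndex : (setLang k).Term (Empty ⊕ Fin n) → ℕ) := by
  intro s t h
  match s, t with
  | .var (.inl e), _ => exact e.elim
  | _, .var (.inl e) => exact e.elim
  | .func f _, _ => exact Empty.elim f
  | _, .func f _ => exact Empty.elim f
  | .var (.inr i), .var (.inr j) => rw [Fin.ext h]

theorem relCode_injective {k l l' : ℕ} {R : SetRel k l} {R' : SetRel k l'} {v : Fin l → ℕ}
    {v' : Fin l' → ℕ} (h : relCode.{u} R v = relCode R' v') :
    l = l' ∧ R ≍ R' ∧ v ≍ v' := by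
  cases R <;> cases R' <;> simp only [relCode, ZFSet.pair_inj, natCode_inj] at h
  · refine ⟨rfl, .rfl, heq_of_eq (funext fun i => ?_)⟩
    fin_cases i
    · exact h.2.1
    · exact h.2.2
  · omega
  · omega
  · obtain ⟨-, h1, h2⟩ := h
    rw [Fin.ext h1]
    refine ⟨rfl, .rfl, heq_of_eq (funext fun i => ?_)⟩
    rw [Subsingleton.elim i 0]
    exact h2

theorem relCode_ne {k l m : ℕ} (R : SetRel k l) (v : Fin l → ℕ) (x : ZFSet.{u})
    (h2 : m ≠ 2) (h3 : m ≠ 3) : relCode R v ≠ ZFSet.pair (natCode m) x := by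
  cases R <;> simp only [relCode, ne_eq, ZFSet.pair_inj, natCode_inj] <;> omega

theorem formulaCode_injective {k n : ℕ} : Function.Injective
    (formulaCode.{u} : (setLang k).BoundedFormula Empty n → ZFSet.{u}) := by
  intro φ ψ h
  induction φ with
  | falsum =>
    cases ψ with
    | falsum => rfl
    | rel => exact absurd h.symm (relCode_ne _ _ _ (by simp) (by simp))
    | _ => simp [formulaCode, natCode_inj] at h
  | equal s t =>
    cases ψ with
    | equal s' t' =>
      simp only [formulaCode, ZFSet.pair_inj, natCode_inj, true_and] at h
      rw [varIndex_injective h.1, varIndex_injective h.2]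
    | rel => exact absurd h.symm (relCode_ne _ _ _ (by simp) (by simp))
    | _ => simp [formulaCode, natCode_inj] at h
  | rel R ts =>
    cases ψ with
    | rel R' ts' =>
      obtain ⟨rfl, hR, hv⟩ := relCode_injective h
      obtain rfl := eq_of_heq hR
      have := eq_of_heq hv
      rw [show ts = ts' from funext fun i => varIndex_injective (congrFun this i)]
    | _ => exact absurd h (relCode_ne _ _ _ (by simp) (by simp))
  | imp φ₁ φ₂ ih₁ ih₂ =>
    cases ψ with
    | imp ψ₁ ψ₂ =>
      simp only [formulaCode, ZFSet.pair_inj, true_and] at h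
      rw [ih₁ h.1, ih₂ h.2]
    | rel => exact absurd h.symm (relCode_ne _ _ _ (by simp) (by simp))
    | _ => simp [formulaCode, natCode_inj] at h
  | all φ ih =>
    cases ψ with
    | all ψ =>
      simp only [formulaCode, ZFSet.pair_inj, true_and] at h
      rw [ih h]
    | rel => exact absurd h.symm (relCode_ne _ _ _ (by simp) (by simp))
    | _ => simp [formulaCode, natCode_inj] at h

variable {M : ZFSet.{u}}

theorem mem_tupleCode {n : ℕ} {v : Fin n → M} {z : ZFSet.{u}} :
    z ∈ tupleCode v ↔ ∃ i : Fin n, ZFSet.pair (natCode i) (v i).1 = z := by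
  simp [tupleCode]

theorem le_of_tupleCode_eq {m n : ℕ} {v : Fin m → M} {w : Fin n → M}
    (h : tupleCode v = tupleCode w) : m ≤ n := by
  by_contra! hlt
  obtain ⟨j, hj⟩ := mem_tupleCode.1 (h ▸ mem_tupleCode.2 ⟨⟨n, hlt⟩, rfl⟩)
  have := natCode_inj.1 (ZFSet.pair_inj.1 hj).1
  exact j.2.ne this

theorem tupleCode_injective {n : ℕ} {v w : Fin n → M} (h : tupleCode v = tupleCode w) :
    v = w := by
  funext i
  obtain ⟨j, hj⟩ := mem_tupleCode.1 (h ▸ mem_tupleCode.2 ⟨i, rfl⟩)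
  obtain ⟨h1, h2⟩ := ZFSet.pair_inj.1 hj
  rw [Fin.ext (natCode_inj.1 h1)] at h2
  exact Subtype.ext h2.symm

theorem tupleCode_snoc {n : ℕ} (v : Fin n → M) (x : M) (z : ZFSet.{u}) :
    z ∈ tupleCode (Fin.snoc v x : Fin (n + 1) → M) ↔
      z ∈ tupleCode v ∨ z = ZFSet.pair (natCode n) x.1 := by
  simp only [mem_tupleCode, Fin.exists_fin_succ', Fin.snoc_castSucc, Fin.snoc_last,
    Fin.val_castSucc, Fin.val_last, eq_comm (a := z)]

/-- A formula code does not record the number of free variables; the length of the tuple does. -/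
theorem satisfies_of_code_eq {A : Set M} {m n : ℕ} {φ : (setLang 1).BoundedFormula Empty m}
    {ψ : (setLang 1).BoundedFormula Empty n} {v : Fin m → M} {w : Fin n → M}
    (hc : formulaCode φ = formulaCode ψ) (ht : tupleCode v = tupleCode w)
    (h : Satisfies M A ψ w) : Satisfies M A φ v := by
  obtain rfl := (le_of_tupleCode_eq ht).antisymm (le_of_tupleCode_eq ht.symm)
  rwa [formulaCode_injective hc, tupleCode_injective ht]

theorem exists_satisfies_of_mem_Def {A D : Set M} (hD : D ∈ Def M A) :
    ∃ (m : ℕ) (φ : (setLang 1).BoundedFormula Empty (m + 1)) (c : Fin m → M),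
      ∀ r, r ∈ D ↔ Satisfies M A φ (Fin.snoc c r) := by
  classical
  let := classStructure M ![A]
  obtain ⟨φ, hφ⟩ := Set.definable_iff_exists_formula_sum.1 (show (Set.univ : Set M).Definable
    (setLang 1) {x : Fin 1 → M | x 0 ∈ D} from hD)
  -- Only finitely many parameters occur. They become the first variables, and the element being
  -- tested becomes the last one.
  let S : Finset (Set.univ : Set M) := φ.freeVarFinset.toLeft
  let e := S.equivFin
  let f : φ.freeVarFinset → Fin (S.card + 1) := fun a => match a with
    | ⟨.inl x, hx⟩ => Fin.castSucc (e ⟨x, Finset.mem_toLeft.2 hx⟩)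
    | ⟨.inr _, _⟩ => Fin.last _
  let ψ : (setLang 1).Formula (Fin (S.card + 1)) := φ.restrictFreeVar f
  let c : Fin S.card → M := fun i => (e.symm i).1.1
  refine ⟨S.card, Language.BoundedFormula.relabel
    (Sum.inr : Fin (S.card + 1) → Empty ⊕ Fin (S.card + 1)) ψ, c, fun r => ?_⟩
  unfold Satisfies
  refine Iff.trans ?_ (Language.Formula.realize_relabel_sumInr ψ).symm
  refine Iff.trans ?_ (Language.BoundedFormula.realize_restrictFreeVar
    (Sum.elim (fun a => a.1) fun _ => r) ?_).symm
  · exact Set.ext_iff.1 hφ (fun _ => r)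
  · rintro ⟨x | i, hx⟩
    · simp [f, c]
    · simp [f]

variable [TransModel M]

theorem relCode_mem_model {k l : ℕ} (R : SetRel k l) (v : Fin l → ℕ) : relCode R v ∈ M := by
  cases R
  · exact pair_mem_model (natCode_mem_model _)
      (pair_mem_model (natCode_mem_model _) (natCode_mem_model _))
  · exact pair_mem_model (natCode_mem_model _)
      (pair_mem_model (natCode_mem_model _) (natCode_mem_model _))

theorem formulaCode_mem_model {k n : ℕ} (φ : (setLang k).BoundedFormula Empty n) :
    formulaCode φ ∈ M := by
  induction φ with
  | falsum => exact pair_mem_model (natCode_mem_model _) empty_mem_model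
  | equal =>
    exact pair_mem_model (natCode_mem_model _)
      (pair_mem_model (natCode_mem_model _) (natCode_mem_model _))
  | rel => exact relCode_mem_model _ _
  | imp _ _ ih₁ ih₂ => exact pair_mem_model (natCode_mem_model _) (pair_mem_model ih₁ ih₂)
  | all _ ih => exact pair_mem_model (natCode_mem_model _) ih

theorem tupleCode_mem_model {n : ℕ} (v : Fin n → M) : tupleCode v ∈ M := by
  induction n with
  | zero =>
    have : tupleCode v = ∅ := by
      ext z
      simp [mem_tupleCode]
    exact this ▸ empty_mem_model
  | succ n ih =>
    have : tupleCode v = insert (ZFSet.pair (natCode n) (v (Fin.last n)).1)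
        (tupleCode (Fin.init v)) := by
      ext z
      conv_lhs => rw [← Fin.snoc_init_self v]
      rw [tupleCode_snoc, ZFSet.mem_insert_iff, or_comm]
    rw [this]
    exact insert_mem_model (pair_mem_model (natCode_mem_model n) (v _).2) (ih _)

/-- For a truth predicate `T`: the formula and the initial parameters coded by `a`
are satisfied by `r`. -/
def CodedBy (T : Set M) (a r : M) : Prop :=
  ∃ e n s q t w m : M, a = pairM e q ∧ q = pairM n s ∧ t ∈ T ∧ t = pairM e w ∧ m = pairM n r ∧
    ∀ z : M, z.1 ∈ w.1 ↔ z.1 ∈ s.1 ∨ z = m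

instance DfnRel.codedBy {k : ℕ} {P : Fin k → Set M} (i : Fin k) : DfnRel P (CodedBy (P i)) := by
  refine ⟨fun f g _ _ => ?_⟩
  unfold CodedBy
  infer_instance

/-- A code is an ordered pair, so `∅` is free to serve in `Meets` as the tag asking for a new one.
-/
theorem not_codedBy_zeroM (T : Set M) (r : M) : ¬ CodedBy T (zeroM M) r := by
  rintro ⟨e, _, _, q, _, _, _, h, -⟩
  have h : (∅ : ZFSet) = ZFSet.pair e.1 q.1 := congrArg Subtype.val h
  refine ZFSet.notMem_empty {e.1} ?_
  rw [h, ZFSet.pair, ZFSet.mem_pair]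
  exact .inl rfl

theorem exists_codedBy_of_mem_Def {A D : Set M} (hD : D ∈ Def M A) :
    ∃ a : M, ∀ r, r ∈ D ↔ CodedBy (Tr M A) a r := by
  obtain ⟨m, φ, c, hφ⟩ := exists_satisfies_of_mem_Def hD
  let e : M := ⟨_, formulaCode_mem_model φ⟩
  let n : M := ⟨_, natCode_mem_model m⟩
  let s : M := ⟨_, tupleCode_mem_model c⟩
  have key : ∀ r w : M, (∀ z : M, z.1 ∈ w.1 ↔ z.1 ∈ s.1 ∨ z = pairM n r) →
      w.1 = tupleCode (Fin.snoc c r : Fin (m + 1) → M) := fun r w hw =>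
    val_eq_of_forall_mem_iff (subset_model ⟨_, tupleCode_mem_model _⟩) fun z => by
      rw [hw, tupleCode_snoc, eq_iff_val]
      rfl
  refine ⟨pairM e (pairM n s), fun r => ?_⟩
  rw [hφ]
  constructor
  · intro h
    refine ⟨e, n, s, _, pairM e ⟨_, tupleCode_mem_model _⟩, _, _, rfl, rfl,
      ⟨m + 1, φ, Fin.snoc c r, rfl, h⟩, rfl, rfl, fun z => ?_⟩
    rw [tupleCode_snoc, eq_iff_val]
    rfl
  · rintro ⟨e', n', s', q, t, w, p, h1, rfl, ⟨l, ψ, v, ht, hψ⟩, rfl, rfl, hw⟩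
    obtain ⟨rfl, hns⟩ := pairM_inj.1 h1
    obtain ⟨rfl, rfl⟩ := pairM_inj.1 hns
    obtain ⟨h2, h3⟩ := ZFSet.pair_inj.1 ht
    exact satisfies_of_code_eq h2 ((key r w hw).symm.trans h3) hψ

end Truth

/-! ### Conditions in `Add(Ord, 1)` -/

section Conditions

theorem rank_pair_lt {o : Ordinal.{u}} (ho : ∀ p < o, Order.succ p < o) {x y : ZFSet.{u}}
    (hx : x.rank < o) (hy : y.rank < o) : (ZFSet.pair x y).rank < o := by
  simp only [ZFSet.pair, ZFSet.rank_pair, ZFSet.rank_singleton]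
  exact max_lt (ho _ (ho _ hx)) (ho _ (max_lt (ho _ hx) (ho _ hy)))

theorem rank_fst_lt (x y : ZFSet.{u}) : x.rank < (ZFSet.pair x y).rank := by
  refine (ZFSet.rank_lt_of_mem (ZFSet.mem_singleton.2 rfl)).trans
    (ZFSet.rank_lt_of_mem (y := {x}) ?_)
  rw [ZFSet.pair, ZFSet.mem_pair]
  exact .inl rfl

theorem isOrdinal_of_pair_mem {β p α : ZFSet.{u}} {i : ZFSet.{u}} (hα : α.IsOrdinal)
    (hp : ZFSet.IsFunc α {∅, {∅}} p) (h : ZFSet.pair β i ∈ p) :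
    β ∈ α ∧ β.IsOrdinal ∧ (i = ∅ ∨ i = {∅}) := by
  obtain ⟨h1, h2⟩ := ZFSet.pair_mem_prod.1 (hp.1 h)
  exact ⟨h1, hα.mem h1, ZFSet.mem_pair.1 h2⟩

theorem exists_pair_of_mem {α p z : ZFSet.{u}}
    (hp : ZFSet.IsFunc α {∅, {∅}} p) (h : z ∈ p) :
    ∃ β ∈ α, z = ZFSet.pair β ∅ ∨ z = ZFSet.pair β {∅} := by
  obtain ⟨β, hβ, i, hi, rfl⟩ := ZFSet.mem_prod.1 (hp.1 h)
  rcases ZFSet.mem_pair.1 hi with rfl | rfl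
  · exact ⟨β, hβ, .inl rfl⟩
  · exact ⟨β, hβ, .inr rfl⟩

variable {M : ZFSet.{u}}

/-- The set `r` is the restriction to an ordinal of the characteristic function of `C`. -/
def IsRestriction [TransModel M] (C : Set M) (r : M) : Prop :=
  ∃ α : M, α.1.IsOrdinal ∧ ∀ z : M, z.1 ∈ r.1 ↔ ∃ β : M, β.1 ∈ α.1 ∧
    ((β ∈ C ∧ z = pairM β (oneM M)) ∨ (β ∉ C ∧ z = pairM β (zeroM M)))

variable [TransModel M]

theorem singleton_empty_ne : ({∅} : ZFSet.{u}) ≠ ∅ := fun h =>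
  ZFSet.not_nonempty_empty (h ▸ ZFSet.singleton_nonempty ∅)

/-- The left side is first-order over `(M, ∈, C)`, which is what the definability of `Meets`
requires. -/
theorem isRestriction_iff {C : Set M} {r : M} :
    IsRestriction C r ↔ r ∈ initialSegments M C := by
  constructor
  · rintro ⟨α, hα, h⟩
    have h1 : ∀ β : M, ZFSet.pair β.1 {∅} ∈ r.1 ↔ β.1 ∈ α.1 ∧ β ∈ C := by
      intro β
      refine (h (pairM β (oneM M))).trans ⟨?_, fun hβ => ⟨β, hβ.1, .inl ⟨hβ.2, rfl⟩⟩⟩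
      rintro ⟨γ, hγ, ⟨hC, e⟩ | ⟨-, e⟩⟩ <;> rw [pairM_inj] at e
      · exact e.1 ▸ ⟨hγ, hC⟩
      · exact absurd (congrArg Subtype.val e.2) singleton_empty_ne
    have h0 : ∀ β : M, ZFSet.pair β.1 ∅ ∈ r.1 ↔ β.1 ∈ α.1 ∧ β ∉ C := by
      intro β
      refine (h (pairM β (zeroM M))).trans ⟨?_, fun hβ => ⟨β, hβ.1, .inr ⟨hβ.2, rfl⟩⟩⟩
      rintro ⟨γ, hγ, ⟨-, e⟩ | ⟨hC, e⟩⟩ <;> rw [pairM_inj] at e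
      · exact absurd (congrArg Subtype.val e.2).symm singleton_empty_ne
      · exact e.1 ▸ ⟨hγ, hC⟩
    refine ⟨⟨α.1, α.2, hα, fun z hz => ?_, fun β hβ => ?_⟩,
      fun β => ⟨fun hβ => ((h1 β).1 hβ).2, fun hβ => ((h0 β).1 hβ).2⟩⟩
    · obtain ⟨β, hβ, ⟨-, e⟩ | ⟨-, e⟩⟩ := (h ⟨z, mem_of_mem hz⟩).1 hz
      · exact ZFSet.mem_prod.2 ⟨β.1, hβ, _, ZFSet.mem_pair.2 (.inr rfl), congrArg Subtype.val e⟩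
      · exact ZFSet.mem_prod.2 ⟨β.1, hβ, _, ZFSet.mem_pair.2 (.inl rfl), congrArg Subtype.val e⟩
    · have hval : ∀ i, ZFSet.pair β i ∈ r.1 → i = ∅ ∨ i = {∅} := by
        intro i hi
        obtain ⟨γ, hγ, ⟨-, e⟩ | ⟨-, e⟩⟩ := (h ⟨_, mem_of_mem hi⟩).1 hi
        · exact .inr (ZFSet.pair_inj.1 (congrArg Subtype.val e)).2
        · exact .inl (ZFSet.pair_inj.1 (congrArg Subtype.val e)).2
      have hβM : β ∈ M := mem_of_mem hβ
      by_cases hC : (⟨β, hβM⟩ : M) ∈ C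
      · refine ⟨{∅}, (h1 ⟨β, hβM⟩).2 ⟨hβ, hC⟩, fun i hi => (hval i hi).resolve_left ?_⟩
        rintro rfl
        exact ((h0 ⟨β, hβM⟩).1 hi).2 hC
      · refine ⟨∅, (h0 ⟨β, hβM⟩).2 ⟨hβ, hC⟩, fun i hi => (hval i hi).resolve_right ?_⟩
        rintro rfl
        exact hC ((h1 ⟨β, hβM⟩).1 hi).2
  · rintro ⟨⟨α, hα, hord, hr⟩, hC⟩
    refine ⟨⟨α, hα⟩, hord, fun z => ⟨fun hz => ?_, ?_⟩⟩
    · obtain ⟨β, hβ, e | e⟩ := exists_pair_of_mem hr hz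
      · have hβM : β ∈ M := mem_of_mem (y := ⟨α, hα⟩) hβ
        exact ⟨⟨β, hβM⟩, hβ, .inr ⟨(hC ⟨β, hβM⟩).2 (e ▸ hz), Subtype.ext e⟩⟩
      · have hβM : β ∈ M := mem_of_mem (y := ⟨α, hα⟩) hβ
        exact ⟨⟨β, hβM⟩, hβ, .inl ⟨(hC ⟨β, hβM⟩).1 (e ▸ hz), Subtype.ext e⟩⟩
    · rintro ⟨β, hβ, h⟩
      obtain ⟨i, hi, -⟩ := hr.2 β.1 hβ
      rcases (isOrdinal_of_pair_mem hord hr hi).2.2 with rfl | rfl <;>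
        rcases h with ⟨h, rfl⟩ | ⟨h, rfl⟩
      · exact absurd h ((hC β).2 hi)
      · exact hi
      · exact hi
      · exact absurd ((hC β).1 hi) h

theorem IsRestriction.subset_total {C : Set M} {p r : M} (hp : IsRestriction C p)
    (hr : IsRestriction C r) : p.1 ⊆ r.1 ∨ r.1 ⊆ p.1 := by
  obtain ⟨α, hα, hp⟩ := hp
  obtain ⟨γ, hγ, hr⟩ := hr
  refine (hα.subset_total hγ).imp (fun h => ?_) fun h => ?_ <;>
    refine subset_iff_forall.2 fun z hz => ?_
  · obtain ⟨β, hβ, h'⟩ := (hp z).1 hz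
    exact (hr z).2 ⟨β, h hβ, h'⟩
  · obtain ⟨β, hβ, h'⟩ := (hr z).1 hz
    exact (hp z).2 ⟨β, h hβ, h'⟩

theorem exists_constant_extension {p : M} {α δ c : ZFSet.{u}} (hδ : δ ∈ M) (hδo : δ.IsOrdinal)
    (hp : ZFSet.IsFunc α {∅, {∅}} p.1) (hα : α ∈ M) (hαδ : α ⊆ δ)
    (hc : c = ∅ ∨ c = {∅}) :
    ∃ q : M, q ∈ AddOrd M ∧ ∀ z, z ∈ q.1 ↔ z ∈ p.1 ∨ ∃ β ∈ δ, β ∉ α ∧ z = ZFSet.pair β c := by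
  have hcM : c ∈ M := by
    rcases hc with rfl | rfl
    · exact empty_mem_model
    · exact singleton_mem_model empty_mem_model
  obtain ⟨b, hb⟩ := image_mem_model (fun β z => z = pairM β ⟨c, hcM⟩)
    ⟨δ \ α, sdiff_mem_model hδ hα⟩ fun x y y' _ h h' => h.trans h'.symm
  have hb' : ∀ z, z ∈ b.1 ↔ ∃ β ∈ δ, β ∉ α ∧ z = ZFSet.pair β c := by
    intro z
    constructor
    · intro hz
      obtain ⟨β, hβ, e⟩ := (hb ⟨z, mem_of_mem hz⟩).1 hz
      obtain ⟨h1, h2⟩ := ZFSet.mem_sdiff.1 hβ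
      exact ⟨β.1, h1, h2, congrArg Subtype.val e⟩
    · rintro ⟨β, h1, h2, rfl⟩
      have hβM : β ∈ M := mem_of_mem (y := ⟨δ, hδ⟩) h1
      exact (hb (pairM ⟨β, hβM⟩ ⟨c, hcM⟩)).2 ⟨⟨β, hβM⟩, ZFSet.mem_sdiff.2 ⟨h1, h2⟩, rfl⟩
  refine ⟨⟨p.1 ∪ b.1, union_mem_model p.2 b.2⟩, ⟨δ, hδ, hδo, fun z hz => ?_, fun β hβ => ?_⟩,
    fun z => ZFSet.mem_union.trans (or_congr_right (hb' z))⟩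
  · rcases ZFSet.mem_union.1 hz with hz | hz
    · obtain ⟨β, hβ, i, hi, rfl⟩ := ZFSet.mem_prod.1 (hp.1 hz)
      exact ZFSet.mem_prod.2 ⟨β, hαδ hβ, i, hi, rfl⟩
    · obtain ⟨β, hβ, -, rfl⟩ := (hb' z).1 hz
      exact ZFSet.mem_prod.2 ⟨β, hβ, c, ZFSet.mem_pair.2 hc, rfl⟩
  · by_cases hβα : β ∈ α
    · obtain ⟨i, hi, huniq⟩ := hp.2 β hβα
      refine ⟨i, ZFSet.mem_union.2 (.inl hi), fun j hj => ?_⟩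
      rcases ZFSet.mem_union.1 hj with hj | hj
      · exact huniq j hj
      · obtain ⟨γ, -, hγ, e⟩ := (hb' _).1 hj
        exact absurd hβα ((ZFSet.pair_inj.1 e).1 ▸ hγ)
    · refine ⟨c, ZFSet.mem_union.2 (.inr ((hb' _).2 ⟨β, hβ, hβα, rfl⟩)), fun j hj => ?_⟩
      rcases ZFSet.mem_union.1 hj with hj | hj
      · exact absurd (ZFSet.pair_mem_prod.1 (hp.1 hj)).1 hβα
      · obtain ⟨γ, -, -, e⟩ := (hb' _).1 hj
        exact (ZFSet.pair_inj.1 e).2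

/-! ### The generic class -/

/-- One step of the construction: `p'` extends `p` by zeros so that its rank is at least that of
`a`, `r` is an extension of `p'` of least rank satisfying `R a` if there is one, and `q`
appends a one. -/
structure IsStep (R : M → M → Prop) (a p p' r q : M) : Prop where
  mem_p' : p' ∈ AddOrd M
  mem_r : r ∈ AddOrd M
  mem_q : q ∈ AddOrd M
  p_subset : p.1 ⊆ p'.1
  p'_subset : p'.1 ⊆ r.1
  r_subset : r.1 ⊆ q.1
  rank_le : a.1.rank ≤ p'.1.rank
  one_mem_p : ∀ β : M, ZFSet.pair β.1 {∅} ∈ p'.1 → ZFSet.pair β.1 {∅} ∈ p.1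
  exists_one : ∃ β : M, ZFSet.pair β.1 {∅} ∈ q.1 ∧ ZFSet.pair β.1 {∅} ∉ p.1
  rank_lt : ∀ o : Ordinal.{u}, (∀ p < o, Order.succ p < o) → r.1.rank < o → q.1.rank < o
  least : (R a r ∧ ∀ r' ∈ AddOrd M, p'.1 ⊆ r'.1 → R a r' → r.1.rank ≤ r'.1.rank) ∨
    (r = p' ∧ ∀ r' ∈ AddOrd M, p'.1 ⊆ r'.1 → ¬ R a r')

theorem exists_zero_extension (a : M) {p : M} (hp : p ∈ AddOrd M) :
    ∃ p' ∈ AddOrd M, p.1 ⊆ p'.1 ∧ a.1.rank ≤ p'.1.rank ∧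
      ∀ β : M, ZFSet.pair β.1 {∅} ∈ p'.1 → ZFSet.pair β.1 {∅} ∈ p.1 := by
  obtain ⟨α, hα, hαo, hp⟩ := hp
  -- The new domain is `o + 1`: it includes `α`, and the pair with first entry `o` forces the rank
  -- up to that of `a`.
  let o := max α.rank a.1.rank
  have ho : o.toZFSet ∈ M := by
    rcases max_choice α.rank a.1.rank with h | h
    · exact toZFSet_mem_model ⟨α, hα⟩ h.le
    · exact toZFSet_mem_model a h.le
  have hαo' : α ⊆ o.toZFSet :=
    (hαo.rank_le_iff_subset (ZFSet.isOrdinal_toZFSet _)).1 (by simp [o])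
  obtain ⟨p', hp', hmem⟩ := exists_constant_extension (c := ∅) (insert_mem_model ho ho)
    (ZFSet.isOrdinal_succ (ZFSet.isOrdinal_toZFSet o)) hp hα
    (fun z hz => ZFSet.mem_insert_of_mem _ (hαo' hz)) (.inl rfl)
  refine ⟨p', hp', fun z hz => (hmem z).2 (.inl hz), ?_, fun β hβ => ?_⟩
  · have h : ZFSet.pair o.toZFSet ∅ ∈ p'.1 :=
      (hmem _).2 (.inr ⟨_, ZFSet.mem_insert _ _, ZFSet.notMem_of_subset hαo', rfl⟩)
    have h1 := (rank_fst_lt o.toZFSet ∅).trans (ZFSet.rank_lt_of_mem h)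
    rw [Ordinal.rank_toZFSet] at h1
    exact (le_max_right _ _).trans h1.le
  · refine ((hmem _).1 hβ).resolve_right ?_
    rintro ⟨γ, -, -, e⟩
    exact singleton_empty_ne (ZFSet.pair_inj.1 e).2

/-- Only one pair is added, and the rank of the domain is at most that of `r`, so the rank cannot
jump past a limit. -/
theorem exists_one_extension {r : M} (hr : r ∈ AddOrd M) :
    ∃ q ∈ AddOrd M, r.1 ⊆ q.1 ∧
      (∃ β : M, ZFSet.pair β.1 {∅} ∈ q.1 ∧ ZFSet.pair β.1 {∅} ∉ r.1) ∧
      ∀ o : Ordinal.{u}, (∀ p < o, Order.succ p < o) → r.1.rank < o → q.1.rank < o := by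
  obtain ⟨α, hα, hαo, hr⟩ := hr
  obtain ⟨q, hq, hmem⟩ := exists_constant_extension (c := {∅}) (insert_mem_model hα hα)
    (ZFSet.isOrdinal_succ hαo) hr hα (fun z hz => ZFSet.mem_insert_of_mem _ hz) (.inr rfl)
  have hq' : q.1 = insert (ZFSet.pair α {∅}) r.1 := by
    ext z
    rw [hmem, ZFSet.mem_insert_iff, or_comm]
    refine or_congr_left ⟨?_, fun h => ⟨α, ZFSet.mem_insert _ _, ZFSet.mem_irrefl _, h⟩⟩
    rintro ⟨β, hβ, hβα, rfl⟩
    rw [(ZFSet.mem_insert_iff.1 hβ).resolve_right hβα]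
  refine ⟨q, hq, fun z hz => (hmem z).2 (.inl hz),
    ⟨⟨α, hα⟩, hq' ▸ ZFSet.mem_insert _ _, fun h => ?_⟩, fun o ho hlt => ?_⟩
  · exact ZFSet.mem_irrefl _ (isOrdinal_of_pair_mem hαo hr h).1
  · have hαr : α.rank ≤ r.1.rank := ZFSet.rank_le_iff.2 fun β hβ => by
      obtain ⟨i, hi, -⟩ := hr.2 β hβ
      exact (rank_fst_lt _ _).trans (ZFSet.rank_lt_of_mem hi)
    have h0 : (0 : Ordinal) < o := bot_le.trans_lt hlt
    rw [hq', ZFSet.rank_insert]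
    refine max_lt (ho _ (rank_pair_lt ho (hαr.trans_lt hlt) ?_)) hlt
    rw [ZFSet.rank_singleton, ZFSet.rank_empty]
    exact ho _ h0

theorem exists_isStep (R : M → M → Prop) (a : M) {p : M} (hp : p ∈ AddOrd M) :
    ∃ p' r q, IsStep R a p p' r q := by
  obtain ⟨p', hp', hpp', hrank, hone⟩ := exists_zero_extension a hp
  have hr : ∃ r ∈ AddOrd M, p'.1 ⊆ r.1 ∧
      ((R a r ∧ ∀ r' ∈ AddOrd M, p'.1 ⊆ r'.1 → R a r' → r.1.rank ≤ r'.1.rank) ∨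
        (r = p' ∧ ∀ r' ∈ AddOrd M, p'.1 ⊆ r'.1 → ¬ R a r')) := by
    by_cases h : ∃ r, r ∈ AddOrd M ∧ p'.1 ⊆ r.1 ∧ R a r
    · obtain ⟨r, ⟨h1, h2, h3⟩, hmin⟩ := exists_min_rank h
      exact ⟨r, h1, h2, .inl ⟨h3, fun r' h1' h2' h3' => hmin r' ⟨h1', h2', h3'⟩⟩⟩
    · exact ⟨p', hp', fun _ hz => hz, .inr ⟨rfl, fun r h1 h2 h3 => h ⟨r, h1, h2, h3⟩⟩⟩
  obtain ⟨r, hr, hpr, hleast⟩ := hr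
  obtain ⟨q, hq, hrq, ⟨β, hβ, hβr⟩, hlt⟩ := exists_one_extension hr
  exact ⟨p', r, q, hp', hr, hq, hpp', hpr, hrq, hrank, hone,
    ⟨β, hβ, fun h => hβr (hpr (hpp' h))⟩, hlt, hleast⟩

theorem empty_mem_AddOrd : zeroM M ∈ AddOrd M :=
  ⟨∅, empty_mem_model, ZFSet.isOrdinal_empty, ZFSet.empty_subset _,
    fun z hz => absurd hz (ZFSet.notMem_empty z)⟩

/-- The relation whose closure ordinals are destroyed by the generic class. Of the two classes,
`P 0` is the class of ordinals and `P 1` is the truth predicate. -/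
def Meets (P : Fin 2 → Set M) (x r : M) : Prop :=
  ∃ a p : M, x = pairM a p ∧ IsRestriction (P 0) r ∧ p.1 ⊆ r.1 ∧
    ((a = zeroM M ∧ ∃ β z : M, z = pairM β (oneM M) ∧ z.1 ∈ r.1 ∧ z.1 ∉ p.1) ∨
      CodedBy (P 1) a r)

instance Dfn.isRestriction {k : ℕ} {P : Fin k → Set M} (i : Fin k) (f : (ℕ → M) → M) [IsTm f] :
    Dfn P (fun v => IsRestriction (P i) (f v)) := by
  unfold IsRestriction
  infer_instance

instance DfnRel.meets {P : Fin 2 → Set M} : DfnRel P (Meets P) := by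
  refine ⟨fun f g _ _ => ?_⟩
  unfold Meets
  have := (DfnRel.codedBy (P := P) 1).out
  infer_instance

theorem exists_generic_not_closed (T : Set M) (hcount : Countable M) :
    ∃ C : Set M, (∀ β ∈ C, β.1.IsOrdinal) ∧
      (∀ a : M, IsDenseClass M {r | CodedBy T a r} →
        (initialSegments M C ∩ {r | CodedBy T a r}).Nonempty) ∧
      ∀ o : Ordinal.{u}, 0 < o → (∀ p < o, Order.succ p < o) → (∃ y : M, o ≤ y.1.rank) →
        ¬ ∀ x r : M, x.1.rank < o → Meets ![C, T] x r →
          ∃ r' : M, r'.1.rank < o ∧ Meets ![C, T] x r' := by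
  have : Nonempty M := ⟨zeroM M⟩
  obtain ⟨a, ha⟩ := exists_surjective_nat M
  choose f g h hstep using fun (a : M) (p : AddOrd M) => exists_isStep (CodedBy T) a p.2
  let s : ℕ → AddOrd M := fun n =>
    Nat.rec ⟨zeroM M, empty_mem_AddOrd⟩ (fun n p => ⟨h (a n) p, (hstep (a n) p).mem_q⟩) n
  let f' : ℕ → M := fun n => f (a n) (s n)
  let g' : ℕ → M := fun n => g (a n) (s n)
  have hs : ∀ n, IsStep (CodedBy T) (a n) (s n).1 (f' n) (g' n) (s (n + 1)).1 :=
    fun n => hstep (a n) (s n)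
  have hmono : ∀ m n, m ≤ n → (s m).1.1 ⊆ (s n).1.1 := by
    intro m n hmn
    induction n, hmn using Nat.le_induction with
    | base => exact fun _ h => h
    | succ n _ ih =>
      exact fun z hz => (hs n).r_subset ((hs n).p'_subset ((hs n).p_subset (ih hz)))
  let C : Set M := {β | ∃ n, ZFSet.pair β.1 {∅} ∈ (s n).1.1}
  have hseg : ∀ n, ∀ x ∈ AddOrd M, x.1 ⊆ (s n).1.1 → x ∈ initialSegments M C := by
    refine fun n x hx hxn => ⟨hx, fun β => ⟨fun hβ => ⟨n, hxn hβ⟩, ?_⟩⟩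
    rintro hβ ⟨m, hm⟩
    obtain ⟨α, -, hα, hfun⟩ := (s (max m n)).2
    have h0 := hmono n _ (le_max_right m n) (hxn hβ)
    have h1 := hmono m _ (le_max_left m n) hm
    obtain ⟨i, -, hi⟩ := hfun.2 β.1 (isOrdinal_of_pair_mem hα hfun h0).1
    exact singleton_empty_ne ((hi _ h1).trans (hi _ h0).symm)
  have hs_seg : ∀ n, IsRestriction C (s n).1 := fun n =>
    isRestriction_iff.2 (hseg n _ (s n).2 fun _ h => h)
  have hg_seg : ∀ n, g' n ∈ initialSegments M C := fun n =>
    hseg (n + 1) _ (hs n).mem_r (hs n).r_subset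
  have hf_seg : ∀ n, f' n ∈ initialSegments M C := fun n =>
    hseg (n + 1) _ (hs n).mem_p' fun _ h => (hs n).r_subset ((hs n).p'_subset h)
  refine ⟨C, ?_, fun b hD => ?_, fun o ho hlim ⟨y, hy⟩ hclosed => ?_⟩
  · rintro β ⟨n, hn⟩
    obtain ⟨α, -, hα, hfun⟩ := (s n).2
    exact (isOrdinal_of_pair_mem hα hfun hn).2.1
  · obtain ⟨n, rfl⟩ := ha b
    obtain ⟨q, hq, hpq⟩ := hD.2 _ (hs n).mem_p'
    rcases (hs n).least with h | h
    · exact ⟨g' n, hg_seg n, h.1⟩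
    · exact absurd hq (h.2 q (hD.1 hq) hpq)
  · have hex : ∃ n, o ≤ (s n).1.1.rank := by
      obtain ⟨n, rfl⟩ := ha y
      refine ⟨n + 1, hy.trans ((hs n).rank_le.trans (ZFSet.rank_mono ?_))⟩
      exact fun z hz => (hs n).r_subset ((hs n).p'_subset hz)
    -- The stages start at `∅`, of rank 0 < `o`, so the first stage to reach `o` is a successor.
    obtain ⟨n, hn, hn'⟩ : ∃ n, (s n).1.1.rank < o ∧ o ≤ (s (n + 1)).1.1.rank := by
      classical
      cases hm : Nat.find hex with
      | zero =>
        have h0 := Nat.find_spec hex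
        rw [hm] at h0
        change o ≤ (∅ : ZFSet).rank at h0
        rw [ZFSet.rank_empty] at h0
        exact absurd ho h0.not_gt
      | succ n =>
        refine ⟨n, not_le.1 (Nat.find_min hex (by omega)), ?_⟩
        rw [← hm]
        exact Nat.find_spec hex
    -- First use of closure, with the tag `∅`; `s (n + 1)` witnesses that the query has an answer.
    obtain ⟨r, hro, b, p, e, hrC, hpr, hr⟩ := hclosed (pairM (zeroM M) (s n).1) (s (n + 1)).1
      (rank_pair_lt hlim (by simpa using ho) hn) <| by
        obtain ⟨β, h1, h2⟩ := (hs n).exists_one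
        exact ⟨_, _, rfl, hs_seg (n + 1), hmono _ _ n.le_succ, .inl ⟨rfl, β, _, rfl, h1, h2⟩⟩
    obtain ⟨rfl, rfl⟩ := pairM_inj.1 e
    obtain ⟨-, β, z, rfl, hβr, hβp⟩ := hr.resolve_right (not_codedBy_zeroM T r)
    -- Initial segments of `C` are comparable, and one inside `p'` would have no one beyond those of
    -- `s n`.
    have hfr : (f' n).1 ⊆ r.1 := by
      refine (hrC.subset_total (isRestriction_iff.2 (hf_seg n))).resolve_left fun h => ?_
      exact hβp ((hs n).one_mem_p β (h hβr))
    have hfo : (f' n).1.rank < o := (ZFSet.rank_mono hfr).trans_lt hro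
    refine hn'.not_gt ((hs n).rank_lt o hlim ?_)
    rcases (hs n).least with ⟨hR, hleast⟩ | ⟨h, -⟩
    -- Second use of closure: the witness below `o` competes with `g' n`, which was chosen of least
    -- rank among all extensions of `p'`, not merely those along `C`.
    · obtain ⟨r, hro, b, p, e, hrC, hpr, hr⟩ := hclosed (pairM (a n) (f' n)) (g' n)
        (rank_pair_lt hlim ((hs n).rank_le.trans_lt hfo) hfo)
        ⟨_, _, rfl, isRestriction_iff.2 (hg_seg n), (hs n).p'_subset, .inr hR⟩
      obtain ⟨rfl, rfl⟩ := pairM_inj.1 e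
      have hr : CodedBy T (a n) r := by
        refine hr.resolve_left fun h => ?_
        rw [h.1] at hR
        exact not_codedBy_zeroM T _ hR
      exact (hleast r (isRestriction_iff.1 hrC).1 hpr hr).trans_lt hro
    · rwa [h]

end Conditions

end ClassTheory

/-! ### The main theorem -/

theorem mainTheorem1 (M : ZFSet.{u}) (hM : M.IsTransitive) (hcount : Countable M)
    (hZFC : ClassTheory.ModelsZFC M) (A : Set M)
    (hGB : ClassTheory.ModelsGB M (ClassTheory.Def M A)) :
    ∃ C : Set M, ClassTheory.IsCohenGeneric M (ClassTheory.Def M A) C ∧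
      ∀ X : Set (Set M), ClassTheory.ModelsGB M X → ¬ (C ∈ X ∧ ClassTheory.Tr M A ∈ X) := by
  have : ClassTheory.TransModel M := ⟨hM, hZFC⟩
  obtain ⟨C, hord, hgen, hclosed⟩ :=
    ClassTheory.exists_generic_not_closed (ClassTheory.Tr M A) hcount
  refine ⟨C, ⟨hord, fun D hD hdense => ?_⟩, fun X hX ⟨hC, hT⟩ => ?_⟩
  · obtain ⟨a, ha⟩ := ClassTheory.exists_codedBy_of_mem_Def hD
    obtain rfl : D = {r | ClassTheory.CodedBy (ClassTheory.Tr M A) a r} := Set.ext ha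
    exact hgen a hdense
  · obtain ⟨o, ho, hlim, hy, h⟩ := hX.exists_closed (P := ![C, ClassTheory.Tr M A])
      (fun i => by fin_cases i <;> assumption) (ClassTheory.Meets ![C, ClassTheory.Tr M A])
    exact hclosed o ho hlim hy h
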